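/- **Setting.** A *Grothendieck-Verdier (GV) category* is a monoidal category $(\mathcal C,\otimes,1)$ together with an object $K$, an anti-equivalence $G\colon\mathcal C\to\mathcal C$ and bijections $\mathrm{Hom}(x\otimes y,K)\cong\mathrm{Hom}(x,Gy)$ natural in $x$ and $y$. It has a second monoidal structure, with product $x\mathbin{\tilde\otimes}y=G^{-1}(Gy\otimes Gx)$, unit $K$ and constraints transported along $G$. A *GV-module category* over $\mathcal C$ is a left module category $(\mathcal M,\triangleright)$ over $(\mathcal C,\otimes)$ such that all functors $c\triangleright-\colon\mathcal M\to\mathcal M$ and $-\triangleright m\colon\mathcal C\to\mathcal M$ have a right adjoint. If $H_c$ is a right adjoint of $c\triangleright-$, then $c\mathbin{\tilde\triangleright}m:=H_{Gc}(m)$ makes $\mathcal M$ a left module category over $(\mathcal C,\tilde\otimes,K)$, and each functor $-\mathbin{\tilde\triangleright}n\colon\mathcal C\to\mathcal M$ has a left adjoint. Write $\underline{\mathrm{Hom}}(m,-)\colon\mathcal M\to\mathcal C$ for the right adjoint of $-\triangleright m$ (it has a canonical structure of a lax module functor over $(\mathcal C,\otimes)$), and $\underline{\mathrm{coHom}}(n,-)\colon\mathcal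 M\to\mathcal C$ for the left adjoint of $-\mathbin{\tilde\triangleright}n$ (it has a canonical structure of an oplax module functor over $(\mathcal C,\tilde\otimes)$). By internal (co)composition, $A_m:=\underline{\mathrm{Hom}}(m,m)$ is an algebra in $(\mathcal C,\otimes)$ and $C_n:=\underline{\mathrm{coHom}}(n,n)$ is a coalgebra in $(\mathcal C,\tilde\otimes)$, and there are functors $$\underline{\mathrm{Hom}}(m,-)\colon\mathcal M\to\mathrm{mod}\text-A_m,\qquad \underline{\mathrm{coHom}}(n,-)\colon\mathcal M\to\mathrm{comod}\text-C_n$$ to right modules and right comodules, which are canonically a lax $(\mathcal C,\otimes)$-module functor and an oplax $(\mathcal C,\tilde\otimes)$-module functor, respectively. An object $m$ is *$\otimes$-admissible* if the lax module functor $\underline{\mathrm{Hom}}(m,-)\colon\mathcal M\to\mathcal C$ is strong and has a right adjoint; $n$ is *$\tilde\otimes$-admissible* if the oplax module functor $\underline{\mathrm{coHom}}(n,-)\colon\mathcal M\to\mathcal C$ is strong and has a left adjoint. An object $m$ is a *$\mathcal C$-generator* if every $x\in\mathcal M$ admits an epimorphism $c\triangleright m\to x$ for some $c\in\mathcal C$;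 $n$ is a *$\mathcal C$-cogenerator* if every $x\in\mathcal M$ admits a monomorphism $x\to d\mathbin{\tilde\triangleright}n$ for some $d\in\mathcal C$. $\mathcal M$ is *algebraic* if it is equivalent, as a $(\mathcal C,\otimes)$-module category, to $\mathrm{mod}\text-A$ for some algebra $A$ in $(\mathcal C,\otimes)$. **Theorem.** Let $\mathcal M$ be a GV-module category over a GV-category $\mathcal C$. 1. If $\mathcal M$ is algebraic, then it has a $\otimes$-admissible $\mathcal C$-generator. 2. Suppose that $\mathcal M$ is balanced (monic epimorphisms are isomorphisms) and has coequalizers; for example, let $\mathcal M$ be abelian, in particular let $\mathcal C$ and $\mathcal M$ be finite abelian. Then $\mathcal M$ is algebraic if and only if it has a $\otimes$-admissible $\mathcal C$-generator. Moreover, for every $m\in\mathcal M$ the canonical lax module functor $\underline{\mathrm{Hom}}(m,-)\colon\mathcal M\to\mathrm{mod}\text-\underline{\mathrm{Hom}}(m,m)$ is an equivalence of $(\mathcal C,\otimes)$-module categories (that is, it is an equivalence and strong) if and only if $m$ is a $\otimes$-admissible $\mathcal C$-generator. 3. Suppose that $\mathcal M$ is balanced and has equalizers; for example, let $\mathcal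 M$ be abelian, in particular let $\mathcal C$ and $\mathcal M$ be finite abelian. Then for every $n\in\mathcal M$ the canonical oplax module functor $\underline{\mathrm{coHom}}(n,-)\colon\mathcal M\to\mathrm{comod}\text-\underline{\mathrm{coHom}}(n,n)$ is an equivalence of $(\mathcal C,\tilde\otimes)$-module categories if and only if $n$ is a $\tilde\otimes$-admissible $\mathcal C$-cogenerator. -/

import Mathlib

open CategoryTheory MonoidalCategory MonoidalLeftAction

namespace GV

universe v₁ v₂ u₁ u₂

/-- Right modules `X ⊗ A ⟶ X` over an algebra `A`. -/
structure RightMod {C : Type u₁} [Category.{v₁} C] [MonoidalCategory C] (A : C) [MonObj A] where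
  X : C
  act : X ⊗ A ⟶ X
  act_one : X ◁ MonObj.one ≫ act = (ρ_ X).hom
  act_mul : X ◁ MonObj.mul ≫ act = (α_ X A A).inv ≫ act ▷ A ≫ act

namespace RightMod

section aux

variable {C : Type u₁} [Category.{v₁} C] [MonoidalCategory C] {A : C}

theorem smul_act_whiskerRight {c c' : C} (f : c ⟶ c') (x : C) (a : x ⊗ A ⟶ x) :
    ((α_ c x A).hom ≫ c ◁ a) ≫ f ▷ x = (f ▷ x) ▷ A ≫ (α_ c' x A).hom ≫ c' ◁ a := by
  simp [whisker_exchange]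

theorem smul_act_whiskerLeft (c : C) {x y : C} (a : x ⊗ A ⟶ x) (b : y ⊗ A ⟶ y) (f : x ⟶ y)
    (h : a ≫ f = f ▷ A ≫ b) :
    ((α_ c x A).hom ≫ c ◁ a) ≫ c ◁ f = (c ◁ f) ▷ A ≫ (α_ c y A).hom ≫ c ◁ b := by
  simp [← MonoidalCategory.whiskerLeft_comp, h]

theorem smul_act_associator (c c' x : C) (a : x ⊗ A ⟶ x) :
    ((α_ (c ⊗ c') x A).hom ≫ (c ⊗ c') ◁ a) ≫ (α_ c c' x).hom =
      (α_ c c' x).hom ▷ A ≫ (α_ c (c' ⊗ x) A).hom ≫ c ◁ ((α_ c' x A).hom ≫ c' ◁ a) := by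
  simp

theorem smul_act_leftUnitor (x : C) (a : x ⊗ A ⟶ x) :
    ((α_ (𝟙_ C) x A).hom ≫ 𝟙_ C ◁ a) ≫ (λ_ x).hom = (λ_ x).hom ▷ A ≫ a := by
  simp

theorem tensor_comp_aux {x y z x' y' z' : C} (f₁ : x ⟶ y) (f₂ : y ⟶ z) (g₁ : x' ⟶ y')
    (g₂ : y' ⟶ z') : (f₁ ≫ f₂) ▷ x' ≫ z ◁ (g₁ ≫ g₂) =
      (f₁ ▷ x' ≫ y ◁ g₁) ≫ (f₂ ▷ y' ≫ z ◁ g₂) := by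
  simp [whisker_exchange_assoc]

theorem associator_natural_aux {x y z x' y' z' : C} (f : x ⟶ x') (g : y ⟶ y') (h : z ⟶ z') :
    ((f ⊗ₘ g) ▷ z ≫ (x' ⊗ y') ◁ h) ≫ (α_ x' y' z').hom =
      (α_ x y z).hom ≫ f ▷ (y ⊗ z) ≫ x' ◁ (g ▷ z ≫ y' ◁ h) := by
  simp [MonoidalCategory.tensorHom_def]

end aux

variable {C : Type u₁} [Category.{v₁} C] [MonoidalCategory C] {A : C} [MonObj A]

/-- Morphisms of right modules. -/
@[ext]
structure Hom (M N : RightMod A) where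
  hom : M.X ⟶ N.X
  act_hom : M.act ≫ hom = hom ▷ A ≫ N.act

theorem Hom.act_hom_assoc {M N : RightMod A} (f : Hom M N) {Z : C} (h : N.X ⟶ Z) :
    M.act ≫ f.hom ≫ h = f.hom ▷ A ≫ N.act ≫ h := by
  rw [← Category.assoc, f.act_hom, Category.assoc]

@[simps id_hom comp_hom]
instance : Category (RightMod A) where
  Hom M N := Hom M N
  id M := ⟨𝟙 M.X, by simp⟩
  comp f g := ⟨f.hom ≫ g.hom, by simp [Hom.act_hom, Hom.act_hom_assoc]⟩

@[ext]
theorem hom_ext {M N : RightMod A} (f g : M ⟶ N) (h : f.hom = g.hom) : f = g := Hom.ext h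

/-- An isomorphism of the underlying objects compatible with the actions. -/
@[simps]
def isoMk {M N : RightMod A} (e : M.X ≅ N.X) (h : M.act ≫ e.hom = e.hom ▷ A ≫ N.act) :
    M ≅ N where
  hom := ⟨e.hom, h⟩
  inv := ⟨e.inv, by
    rw [← cancel_epi (e.hom ▷ A), ← Category.assoc, ← h]; simp⟩

/-- The object `c ⊗ M`, with the action of `A` on `M`. -/
@[simps]
def smul (c : C) (M : RightMod A) : RightMod A where
  X := c ⊗ M.X
  act := (α_ c M.X A).hom ≫ c ◁ M.act
  act_one := by
    rw [MonoidalCategory.tensor_whiskerLeft]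
    simp [← MonoidalCategory.whiskerLeft_comp, act_one]
  act_mul := by
    simp [← MonoidalCategory.whiskerLeft_comp, act_mul]

/-- Right modules over `A` form a left module category over `C`. -/
instance : MonoidalLeftAction C (RightMod A) where
  actionObj c M := smul c M
  actionHomLeft f M := ⟨f ▷ M.X, smul_act_whiskerRight f M.X M.act⟩
  actionHomRight c {M N} f := ⟨c ◁ f.hom, smul_act_whiskerLeft c M.act N.act f.hom f.act_hom⟩
  actionAssocIso c c' M := isoMk (α_ c c' M.X) (smul_act_associator c c' M.X M.act)
  actionUnitIso M := isoMk (λ_ M.X) (smul_act_leftUnitor M.X M.act)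
  actionHom_def _ _ := rfl
  actionHomRight_id c M := hom_ext _ _ (actionHomRight_id (D := C) c M.X)
  id_actionHomLeft c M := hom_ext _ _ (id_actionHomLeft (D := C) c M.X)
  actionHom_comp f₁ f₂ g₁ g₂ := hom_ext _ _ (tensor_comp_aux f₁ f₂ g₁.hom g₂.hom)
  actionAssocIso_hom_naturality f g h := hom_ext _ _ (associator_natural_aux f g h.hom)
  actionUnitIso_hom_naturality f := hom_ext _ _
    (actionUnitIso_hom_naturality (C := C) (D := C) f.hom)
  whiskerLeft_actionHomLeft c _ _ f M := hom_ext _ _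
    (whiskerLeft_actionHomLeft (D := C) c f M.X)
  whiskerRight_actionHomLeft c f M := hom_ext _ _
    (whiskerRight_actionHomLeft (D := C) c f M.X)
  associator_actionHom c₁ c₂ c₃ M := hom_ext _ _ (associator_actionHom (D := C) c₁ c₂ c₃ M.X)
  leftUnitor_actionHom c M := hom_ext _ _ (leftUnitor_actionHom (D := C) c M.X)
  rightUnitor_actionHom c M := hom_ext _ _ (rightUnitor_actionHom (D := C) c M.X)

end RightMod

/-- Right comodules `X ⟶ X ⊗ Z` over a coalgebra `Z`. -/
structure RightComod {C : Type u₁} [Category.{v₁} C] [MonoidalCategory C] (Z : C) [ComonObj Z] where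
  X : C
  coact : X ⟶ X ⊗ Z
  coact_counit : coact ≫ X ◁ ComonObj.counit = (ρ_ X).inv
  coact_comul : coact ≫ X ◁ ComonObj.comul = coact ≫ coact ▷ Z ≫ (α_ X Z Z).hom

namespace RightComod

section aux

variable {C : Type u₁} [Category.{v₁} C] [MonoidalCategory C] {A : C}

theorem smul_coact_whiskerRight {c c' : C} (f : c ⟶ c') (x : C) (a : x ⟶ x ⊗ A) :
    (c ◁ a ≫ (α_ c x A).inv) ≫ (f ▷ x) ▷ A = f ▷ x ≫ c' ◁ a ≫ (α_ c' x A).inv := by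
  rw [← whisker_exchange_assoc]
  simp

theorem smul_coact_whiskerLeft (c : C) {x y : C} (a : x ⟶ x ⊗ A) (b : y ⟶ y ⊗ A) (f : x ⟶ y)
    (h : a ≫ f ▷ A = f ≫ b) :
    (c ◁ a ≫ (α_ c x A).inv) ≫ (c ◁ f) ▷ A = c ◁ f ≫ c ◁ b ≫ (α_ c y A).inv := by
  have h' : c ◁ a ≫ c ◁ f ▷ A = c ◁ f ≫ c ◁ b := by
    rw [← MonoidalCategory.whiskerLeft_comp, h, MonoidalCategory.whiskerLeft_comp]
  simp [reassoc_of% h']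

theorem smul_coact_associator (c c' x : C) (a : x ⟶ x ⊗ A) :
    ((c ⊗ c') ◁ a ≫ (α_ (c ⊗ c') x A).inv) ≫ (α_ c c' x).hom ▷ A =
      (α_ c c' x).hom ≫ c ◁ (c' ◁ a ≫ (α_ c' x A).inv) ≫ (α_ c (c' ⊗ x) A).inv := by
  simp

theorem smul_coact_leftUnitor (x : C) (a : x ⟶ x ⊗ A) :
    (𝟙_ C ◁ a ≫ (α_ (𝟙_ C) x A).inv) ≫ (λ_ x).hom ▷ A = (λ_ x).hom ≫ a := by
  simp

end aux

variable {C : Type u₁} [Category.{v₁} C] [MonoidalCategory C] {Z : C} [ComonObj Z]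

/-- Morphisms of right comodules. -/
@[ext]
structure Hom (M N : RightComod Z) where
  hom : M.X ⟶ N.X
  coact_hom : M.coact ≫ hom ▷ Z = hom ≫ N.coact

theorem Hom.coact_hom_assoc {M N : RightComod Z} (f : Hom M N) {Y : C} (h : N.X ⊗ Z ⟶ Y) :
    M.coact ≫ f.hom ▷ Z ≫ h = f.hom ≫ N.coact ≫ h := by
  rw [← Category.assoc, f.coact_hom, Category.assoc]

@[simps id_hom comp_hom]
instance : Category (RightComod Z) where
  Hom M N := Hom M N
  id M := ⟨𝟙 M.X, by simp⟩
  comp f g := ⟨f.hom ≫ g.hom, by simp [← Hom.coact_hom, Hom.coact_hom_assoc]⟩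

@[ext]
theorem hom_ext {M N : RightComod Z} (f g : M ⟶ N) (h : f.hom = g.hom) : f = g := Hom.ext h

/-- An isomorphism of the underlying objects compatible with the coactions. -/
@[simps]
def isoMk {M N : RightComod Z} (e : M.X ≅ N.X) (h : M.coact ≫ e.hom ▷ Z = e.hom ≫ N.coact) :
    M ≅ N where
  hom := ⟨e.hom, h⟩
  inv := ⟨e.inv, by
    rw [← cancel_epi e.hom, ← Category.assoc, ← h]; simp⟩

/-- The object `c ⊗ M`, with the coaction of `Z` on `M`. -/
@[simps]
def smul (c : C) (M : RightComod Z) : RightComod Z where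
  X := c ⊗ M.X
  coact := c ◁ M.coact ≫ (α_ c M.X Z).inv
  coact_counit := by
    have h : c ◁ M.coact ≫ c ◁ M.X ◁ ComonObj.counit = c ◁ (ρ_ M.X).inv := by
      rw [← MonoidalCategory.whiskerLeft_comp, coact_counit]
    simp [reassoc_of% h]
  coact_comul := by
    have h : c ◁ M.coact ≫ c ◁ M.X ◁ ComonObj.comul =
        c ◁ M.coact ≫ c ◁ M.coact ▷ Z ≫ c ◁ (α_ M.X Z Z).hom := by
      simp only [← MonoidalCategory.whiskerLeft_comp, coact_comul]
    simp [reassoc_of% h]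

/-- Right comodules over `Z` form a left module category over `C`. -/
instance : MonoidalLeftAction C (RightComod Z) where
  actionObj c M := smul c M
  actionHomLeft f M := ⟨f ▷ M.X, smul_coact_whiskerRight f M.X M.coact⟩
  actionHomRight c {M N} f :=
    ⟨c ◁ f.hom, smul_coact_whiskerLeft c M.coact N.coact f.hom f.coact_hom⟩
  actionAssocIso c c' M := isoMk (α_ c c' M.X) (smul_coact_associator c c' M.X M.coact)
  actionUnitIso M := isoMk (λ_ M.X) (smul_coact_leftUnitor M.X M.coact)
  actionHom_def _ _ := rfl
  actionHomRight_id c M := hom_ext _ _ (actionHomRight_id (D := C) c M.X)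
  id_actionHomLeft c M := hom_ext _ _ (id_actionHomLeft (D := C) c M.X)
  actionHom_comp f₁ f₂ g₁ g₂ := hom_ext _ _
    (RightMod.tensor_comp_aux f₁ f₂ g₁.hom g₂.hom)
  actionAssocIso_hom_naturality f g h := hom_ext _ _
    (RightMod.associator_natural_aux f g h.hom)
  actionUnitIso_hom_naturality f := hom_ext _ _
    (actionUnitIso_hom_naturality (C := C) (D := C) f.hom)
  whiskerLeft_actionHomLeft c _ _ f M := hom_ext _ _
    (whiskerLeft_actionHomLeft (D := C) c f M.X)
  whiskerRight_actionHomLeft c f M := hom_ext _ _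
    (whiskerRight_actionHomLeft (D := C) c f M.X)
  associator_actionHom c₁ c₂ c₃ M := hom_ext _ _ (associator_actionHom (D := C) c₁ c₂ c₃ M.X)
  leftUnitor_actionHom c M := hom_ext _ _ (leftUnitor_actionHom (D := C) c M.X)
  rightUnitor_actionHom c M := hom_ext _ _ (rightUnitor_actionHom (D := C) c M.X)

end RightComod

section InternalHom

variable (C : Type u₁) [Category.{v₁} C] [MonoidalCategory C]
  {M : Type u₂} [Category.{v₂} M] [MonoidalLeftAction C M]

/-- The internal Hom `iHom(m, -)`: the right adjoint of `c ↦ c ▷ m`. -/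
noncomputable def iHom (m : M) [(actionRight C m).IsLeftAdjoint] : M ⥤ C :=
  (actionRight C m).rightAdjoint

namespace iHom

variable (m : M) [(actionRight C m).IsLeftAdjoint]

/-- The defining adjunction of the internal Hom. -/
noncomputable def adj : actionRight C m ⊣ iHom C m :=
  Adjunction.ofIsLeftAdjoint _

/-- The evaluation `iHom(m, x) ▷ m ⟶ x`. -/
noncomputable def ev (x : M) : (iHom C m).obj x ⊙ₗ m ⟶ x := (adj C m).counit.app x

variable {C m} in
/-- The adjunction bijection `Hom(c ▷ m, x) → Hom(c, iHom(m, x))`. -/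
noncomputable def lift {c : C} {x : M} (f : c ⊙ₗ m ⟶ x) : c ⟶ (iHom C m).obj x :=
  (adj C m).homEquiv c x f

variable {C m} in
@[simp]
theorem lift_ev {c : C} {x : M} (f : c ⊙ₗ m ⟶ x) : lift f ⊵ₗ m ≫ ev C m x = f :=
  ((adj C m).homEquiv_counit _ _ _).symm.trans (((adj C m).homEquiv c x).symm_apply_apply f)

variable {C m} in
@[simp]
theorem lift_ev_assoc {c : C} {x y : M} (f : c ⊙ₗ m ⟶ x) (h : x ⟶ y) :
    lift f ⊵ₗ m ≫ ev C m x ≫ h = f ≫ h := by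
  rw [← Category.assoc, lift_ev]

variable {C m} in
theorem hom_ext {c : C} {x : M} {f g : c ⟶ (iHom C m).obj x}
    (h : f ⊵ₗ m ≫ ev C m x = g ⊵ₗ m ≫ ev C m x) : f = g :=
  ((adj C m).homEquiv c x).symm.injective
    (((adj C m).homEquiv_counit _ _ _).trans (h.trans ((adj C m).homEquiv_counit _ _ _).symm))

@[simp]
theorem map_ev {x y : M} (f : x ⟶ y) :
    (iHom C m).map f ⊵ₗ m ≫ ev C m y = ev C m x ≫ f :=
  (adj C m).counit.naturality f

@[simp]
theorem map_ev_assoc {x y z : M} (f : x ⟶ y) (h : y ⟶ z) :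
    (iHom C m).map f ⊵ₗ m ≫ ev C m y ≫ h = ev C m x ≫ f ≫ h := by
  rw [← Category.assoc, map_ev, Category.assoc]

/-- The canonical morphism `c ⊗ iHom(m, x) ⟶ iHom(m, c ▷ x)`. -/
noncomputable def lineator (c : C) (x : M) : c ⊗ (iHom C m).obj x ⟶ (iHom C m).obj (c ⊙ₗ x) :=
  lift ((αₗ c _ m).hom ≫ c ⊴ₗ ev C m x)

@[simp]
theorem lineator_ev (c : C) (x : M) :
    lineator C m c x ⊵ₗ m ≫ ev C m (c ⊙ₗ x) = (αₗ c _ m).hom ≫ c ⊴ₗ ev C m x :=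
  lift_ev _

@[simp]
theorem lineator_ev_assoc (c : C) (x : M) {y : M} (h : c ⊙ₗ x ⟶ y) :
    lineator C m c x ⊵ₗ m ≫ ev C m (c ⊙ₗ x) ≫ h =
      (αₗ c _ m).hom ≫ c ⊴ₗ ev C m x ≫ h := by
  rw [← Category.assoc, lineator_ev, Category.assoc]

/-- The canonical lax module functor structure on `iHom(m, -)`. -/
noncomputable instance laxLeftLinear : (iHom C m).LaxLeftLinear C where
  μₗ c x := lineator C m c x
  μₗ_naturality_left f x := hom_ext (by
    simp [action_exchange])
  μₗ_naturality_right c _ _ f := hom_ext (by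
    simp [← actionHomRight_comp])
  μₗ_associativity c c' x := hom_ext (by
    simp [← actionHomRight_comp]
    simp)
  μₗ_unitality x := hom_ext (by
    simp)

/-- Internal composition `iHom(n, l) ⊗ iHom(m, n) ⟶ iHom(m, l)`. -/
noncomputable def comp (m n l : M) [(actionRight C m).IsLeftAdjoint]
    [(actionRight C n).IsLeftAdjoint] :
    (iHom C n).obj l ⊗ (iHom C m).obj n ⟶ (iHom C m).obj l :=
  lift ((αₗ _ _ m).hom ≫ (iHom C n).obj l ⊴ₗ ev C m n ≫ ev C n l)

theorem comp_ev (m n l : M) [(actionRight C m).IsLeftAdjoint]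
    [(actionRight C n).IsLeftAdjoint] :
    comp C m n l ⊵ₗ m ≫ ev C m l = (αₗ _ _ m).hom ≫ (iHom C n).obj l ⊴ₗ ev C m n ≫ ev C n l :=
  lift_ev _

attribute [simp] comp_ev

@[simp]
theorem comp_ev_assoc (m n l : M) [(actionRight C m).IsLeftAdjoint]
    [(actionRight C n).IsLeftAdjoint] {y : M} (h : l ⟶ y) :
    comp C m n l ⊵ₗ m ≫ ev C m l ≫ h =
      (αₗ _ _ m).hom ≫ (iHom C n).obj l ⊴ₗ ev C m n ≫ ev C n l ≫ h := by
  rw [← Category.assoc, comp_ev]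
  simp only [Category.assoc]

theorem comp_assoc (m n l k : M) [(actionRight C m).IsLeftAdjoint]
    [(actionRight C n).IsLeftAdjoint] [(actionRight C l).IsLeftAdjoint] :
    comp C n l k ▷ (iHom C m).obj n ≫ comp C m n k =
      (α_ _ _ _).hom ≫ (iHom C l).obj k ◁ comp C m n l ≫ comp C m l k :=
  hom_ext (by
    simp only [comp_actionHomLeft, whiskerRight_actionHomLeft, whiskerLeft_actionHomLeft,
      Category.assoc, comp_ev, Iso.inv_hom_id_assoc, ← action_exchange_assoc,
      ← actionHomRight_comp_assoc, tensor_actionHomRight]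
    simp only [actionHomRight_comp, Category.assoc, associator_actionHom_assoc])

theorem comp_map (m n : M) [(actionRight C m).IsLeftAdjoint]
    [(actionRight C n).IsLeftAdjoint] {x y : M} (f : x ⟶ y) :
    comp C m n x ≫ (iHom C m).map f = (iHom C n).map f ▷ _ ≫ comp C m n y :=
  hom_ext (by
    simp [whiskerRight_actionHomLeft, -actionHomLeft_action, ← action_exchange_assoc])

theorem lineator_comp (m n : M) [(actionRight C m).IsLeftAdjoint]
    [(actionRight C n).IsLeftAdjoint] (c : C) (x : M) :
    ((α_ c ((iHom C n).obj x) ((iHom C m).obj n)).hom ≫ c ◁ comp C m n x) ≫ lineator C m c x =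
      lineator C n c x ▷ (iHom C m).obj n ≫ comp C m n (c ⊙ₗ x) :=
  hom_ext (by
    simp [whiskerRight_actionHomLeft, -actionHomLeft_action, ← action_exchange_assoc,
      ← actionHomRight_comp]
    simp)

/-- The unit `𝟙 ⟶ iHom(m, m)`. -/
noncomputable def unit : 𝟙_ C ⟶ (iHom C m).obj m := lift (λₗ m).hom

theorem unit_ev : unit C m ⊵ₗ m ≫ ev C m m = (λₗ m).hom := lift_ev _

theorem unit_comp (x : M) [(actionRight C x).IsLeftAdjoint] :
    unit C x ▷ (iHom C m).obj x ≫ comp C m x x = (λ_ _).hom :=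
  hom_ext (by
    simp [whiskerRight_actionHomLeft, -actionHomLeft_action, ← action_exchange_assoc, unit_ev])

theorem comp_unit (x : M) :
    (iHom C m).obj x ◁ unit C m ≫ comp C m m x = (ρ_ _).hom :=
  hom_ext (by
    simp [← actionHomRight_comp_assoc, unit_ev])

end iHom

/-- The internal endomorphism object `A_m = iHom(m, m)`. -/
noncomputable def iEnd (m : M) [(actionRight C m).IsLeftAdjoint] : C := (iHom C m).obj m

variable (m : M) [(actionRight C m).IsLeftAdjoint]

/-- The algebra structure on `A_m = iHom(m, m)`. -/
noncomputable instance : MonObj (iEnd C m) where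
  one := iHom.unit C m
  mul := iHom.comp C m m m
  one_mul := iHom.unit_comp C m m
  mul_one := iHom.comp_unit C m m
  mul_assoc := iHom.comp_assoc C m m m m

/-- The right `A_m`-module `iHom(m, x)`. -/
@[simps]
noncomputable def iHomModObj (x : M) : RightMod (iEnd C m) where
  X := (iHom C m).obj x
  act := iHom.comp C m m x
  act_one := iHom.comp_unit C m x
  act_mul := by
    have := iHom.comp_assoc C m m m x
    exact (Iso.eq_inv_comp _).mpr this.symm

/-- The functor `iHom(m, -) : M ⥤ mod-A_m`. -/
@[simps]
noncomputable def iHomMod : M ⥤ RightMod (iEnd C m) where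
  obj x := iHomModObj C m x
  map f := ⟨(iHom C m).map f, iHom.comp_map C m m f⟩
  map_id x := RightMod.hom_ext _ _ ((iHom C m).map_id x)
  map_comp f g := RightMod.hom_ext _ _ ((iHom C m).map_comp f g)

/-- The canonical lax module functor structure on `iHom(m, -) : M ⥤ mod-A_m`. -/
noncomputable instance iHomMod.laxLeftLinear : (iHomMod C m).LaxLeftLinear C where
  μₗ c x := ⟨iHom.lineator C m c x, iHom.lineator_comp C m m c x⟩
  μₗ_naturality_left f x := RightMod.hom_ext _ _
    (Functor.LaxLeftLinear.μₗ_naturality_left (iHom C m) f x)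
  μₗ_naturality_right c _ _ f := RightMod.hom_ext _ _
    (Functor.LaxLeftLinear.μₗ_naturality_right (iHom C m) c f)
  μₗ_associativity c c' x := RightMod.hom_ext _ _
    (Functor.LaxLeftLinear.μₗ_associativity (iHom C m) c c' x)
  μₗ_unitality x := RightMod.hom_ext _ _
    (Functor.LaxLeftLinear.μₗ_unitality (C := C) (iHom C m) x)

end InternalHom

section InternalCoHom

variable (C : Type u₁) [Category.{v₁} C] [MonoidalCategory C]
  {M : Type u₂} [Category.{v₂} M] [MonoidalLeftAction C M]

variable {C} in
theorem leftUnitor_inv_actionHom (c : C) (x : M) :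
    (λ_ c).inv ⊵ₗ x = (λₗ (c ⊙ₗ x)).inv ≫ (αₗ (𝟙_ C) c x).inv := by
  rw [← cancel_epi ((λ_ c).hom ⊵ₗ x), ← comp_actionHomLeft]
  simp

variable {C} in
theorem rightUnitor_inv_actionHom (c : C) (x : M) :
    (ρ_ c).inv ⊵ₗ x = c ⊴ₗ (λₗ x).inv ≫ (αₗ c (𝟙_ C) x).inv := by
  rw [← cancel_epi ((ρ_ c).hom ⊵ₗ x), ← comp_actionHomLeft]
  simp

variable {C} in
theorem associator_hom_actionHom (a b c : C) (x : M) :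
    (α_ a b c).hom ⊵ₗ x = (αₗ (a ⊗ b) c x).hom ≫ (αₗ a b (c ⊙ₗ x)).hom ≫
      a ⊴ₗ (αₗ b c x).inv ≫ (αₗ a (b ⊗ c) x).inv := by
  rw [← associator_actionHom_assoc]
  simp

variable {C} in
theorem associator_inv_actionHom (a b c : C) (x : M) :
    (α_ a b c).inv ⊵ₗ x = (αₗ a (b ⊗ c) x).hom ≫ a ⊴ₗ (αₗ b c x).hom ≫
      (αₗ a b (c ⊙ₗ x)).inv ≫ (αₗ (a ⊗ b) c x).inv := by
  rw [← cancel_epi ((α_ a b c).hom ⊵ₗ x), ← comp_actionHomLeft]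
  simp

/-- The internal coHom `icoHom(n, -)`: the left adjoint of `c ↦ c ▷ n`. -/
noncomputable def icoHom (n : M) [(actionRight C n).IsRightAdjoint] : M ⥤ C :=
  (actionRight C n).leftAdjoint

namespace icoHom

variable (n : M) [(actionRight C n).IsRightAdjoint]

/-- The defining adjunction of the internal coHom. -/
noncomputable def adj : icoHom C n ⊣ actionRight C n :=
  Adjunction.ofIsRightAdjoint _

/-- The coevaluation `x ⟶ icoHom(n, x) ▷ n`. -/
noncomputable def coev (x : M) : x ⟶ (icoHom C n).obj x ⊙ₗ n := (adj C n).unit.app x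

variable {C n} in
/-- The adjunction bijection `Hom(x, c ▷ n) → Hom(icoHom(n, x), c)`. -/
noncomputable def lift {c : C} {x : M} (f : x ⟶ c ⊙ₗ n) : (icoHom C n).obj x ⟶ c :=
  ((adj C n).homEquiv x c).symm f

variable {C n} in
@[simp]
theorem coev_lift {c : C} {x : M} (f : x ⟶ c ⊙ₗ n) : coev C n x ≫ lift f ⊵ₗ n = f :=
  ((adj C n).homEquiv_unit _ _ _).symm.trans (((adj C n).homEquiv x c).apply_symm_apply f)

variable {C n} in
@[simp]
theorem coev_lift_assoc {c : C} {x y : M} (f : x ⟶ c ⊙ₗ n) (h : c ⊙ₗ n ⟶ y) :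
    coev C n x ≫ lift f ⊵ₗ n ≫ h = f ≫ h := by
  rw [← Category.assoc, coev_lift]

variable {C n} in
theorem hom_ext {c : C} {x : M} {f g : (icoHom C n).obj x ⟶ c}
    (h : coev C n x ≫ f ⊵ₗ n = coev C n x ≫ g ⊵ₗ n) : f = g :=
  ((adj C n).homEquiv x c).injective
    (((adj C n).homEquiv_unit _ _ _).trans (h.trans ((adj C n).homEquiv_unit _ _ _).symm))

@[simp]
theorem coev_map {x y : M} (f : x ⟶ y) :
    coev C n x ≫ (icoHom C n).map f ⊵ₗ n = f ≫ coev C n y :=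
  ((adj C n).unit.naturality f).symm

@[simp]
theorem coev_map_assoc {x y z : M} (f : x ⟶ y) (h : (icoHom C n).obj y ⊙ₗ n ⟶ z) :
    coev C n x ≫ (icoHom C n).map f ⊵ₗ n ≫ h = f ≫ coev C n y ≫ h := by
  rw [← Category.assoc, coev_map, Category.assoc]

/-- The canonical morphism `icoHom(n, c ▷ x) ⟶ c ⊗ icoHom(n, x)`. -/
noncomputable def colineator (c : C) (x : M) :
    (icoHom C n).obj (c ⊙ₗ x) ⟶ c ⊗ (icoHom C n).obj x :=
  lift (c ⊴ₗ coev C n x ≫ (αₗ c _ n).inv)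

@[simp]
theorem coev_colineator (c : C) (x : M) :
    coev C n (c ⊙ₗ x) ≫ colineator C n c x ⊵ₗ n = c ⊴ₗ coev C n x ≫ (αₗ c _ n).inv :=
  coev_lift _

@[simp]
theorem coev_colineator_assoc (c : C) (x : M) {y : M}
    (h : (c ⊗ (icoHom C n).obj x) ⊙ₗ n ⟶ y) :
    coev C n (c ⊙ₗ x) ≫ colineator C n c x ⊵ₗ n ≫ h =
      c ⊴ₗ coev C n x ≫ (αₗ c _ n).inv ≫ h := by
  rw [← Category.assoc, coev_colineator, Category.assoc]

/-- The canonical oplax module functor structure on `icoHom(n, -)`. -/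
noncomputable instance oplaxLeftLinear : (icoHom C n).OplaxLeftLinear C where
  δₗ c x := colineator C n c x
  δₗ_naturality_left f x := hom_ext (by
    simp [← action_exchange_assoc])
  δₗ_naturality_right c _ _ f := hom_ext (by
    have h := congrArg (c ⊴ₗ ·) (coev_map C n f)
    simp only [actionHomRight_comp] at h
    simp [reassoc_of% h])
  δₗ_associativity c c' x := hom_ext (by
    have h := congrArg (c ⊴ₗ ·) (coev_colineator C n c' x)
    simp only [actionHomRight_comp] at h
    simp [reassoc_of% h, associator_hom_actionHom])
  δₗ_unitality_inv x := hom_ext (by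
    simp [leftUnitor_inv_actionHom])

/-- Internal cocomposition `icoHom(m, l) ⟶ icoHom(n, l) ⊗ icoHom(m, n)`. -/
noncomputable def comp (m n l : M) [(actionRight C m).IsRightAdjoint]
    [(actionRight C n).IsRightAdjoint] :
    (icoHom C m).obj l ⟶ (icoHom C n).obj l ⊗ (icoHom C m).obj n :=
  lift (coev C n l ≫ (icoHom C n).obj l ⊴ₗ coev C m n ≫ (αₗ _ _ m).inv)

theorem coev_comp (m n l : M) [(actionRight C m).IsRightAdjoint]
    [(actionRight C n).IsRightAdjoint] :
    coev C m l ≫ comp C m n l ⊵ₗ m =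
      coev C n l ≫ (icoHom C n).obj l ⊴ₗ coev C m n ≫ (αₗ _ _ m).inv :=
  coev_lift _

attribute [simp] coev_comp

@[simp]
theorem coev_comp_assoc (m n l : M) [(actionRight C m).IsRightAdjoint]
    [(actionRight C n).IsRightAdjoint] {y : M}
    (h : ((icoHom C n).obj l ⊗ (icoHom C m).obj n) ⊙ₗ m ⟶ y) :
    coev C m l ≫ comp C m n l ⊵ₗ m ≫ h =
      coev C n l ≫ (icoHom C n).obj l ⊴ₗ coev C m n ≫ (αₗ _ _ m).inv ≫ h := by
  rw [← Category.assoc, coev_comp]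
  simp only [Category.assoc]

theorem comp_assoc (m n l k : M) [(actionRight C m).IsRightAdjoint]
    [(actionRight C n).IsRightAdjoint] [(actionRight C l).IsRightAdjoint] :
    comp C m l k ≫ (icoHom C l).obj k ◁ comp C m n l =
      comp C m n k ≫ comp C n l k ▷ (icoHom C m).obj n ≫ (α_ _ _ _).hom :=
  hom_ext (by
    have h := congrArg ((icoHom C l).obj k ⊴ₗ ·) (coev_comp C m n l)
    simp only [actionHomRight_comp] at h
    simp [whiskerRight_actionHomLeft, -actionHomLeft_action, action_exchange_assoc,
      reassoc_of% h, associator_hom_actionHom])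

theorem map_comp (m n : M) [(actionRight C m).IsRightAdjoint]
    [(actionRight C n).IsRightAdjoint] {x y : M} (f : x ⟶ y) :
    comp C m n x ≫ (icoHom C n).map f ▷ _ = (icoHom C m).map f ≫ comp C m n y :=
  hom_ext (by
    simp [whiskerRight_actionHomLeft, -actionHomLeft_action, action_exchange_assoc])

theorem colineator_comp (m n : M) [(actionRight C m).IsRightAdjoint]
    [(actionRight C n).IsRightAdjoint] (c : C) (x : M) :
    comp C m n (c ⊙ₗ x) ≫ colineator C n c x ▷ (icoHom C m).obj n =
      colineator C m c x ≫ c ◁ comp C m n x ≫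
        (α_ c ((icoHom C n).obj x) ((icoHom C m).obj n)).inv :=
  hom_ext (by
    have h := congrArg (c ⊴ₗ ·) (coev_comp C m n x)
    simp only [actionHomRight_comp] at h
    simp [whiskerRight_actionHomLeft, -actionHomLeft_action, action_exchange_assoc,
      reassoc_of% h, associator_inv_actionHom])

/-- The counit `icoHom(n, n) ⟶ 𝟙`. -/
noncomputable def counit : (icoHom C n).obj n ⟶ 𝟙_ C := lift (λₗ n).inv

theorem coev_counit : coev C n n ≫ counit C n ⊵ₗ n = (λₗ n).inv := coev_lift _

theorem coev_counit_assoc {y : M} (h : 𝟙_ C ⊙ₗ n ⟶ y) :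
    coev C n n ≫ counit C n ⊵ₗ n ≫ h = (λₗ n).inv ≫ h := by
  rw [← Category.assoc, coev_counit]

theorem comp_counit (x : M) [(actionRight C x).IsRightAdjoint] :
    comp C n x x ≫ counit C x ▷ (icoHom C n).obj x = (λ_ _).inv :=
  hom_ext (by
    simp [whiskerRight_actionHomLeft, -actionHomLeft_action, action_exchange_assoc,
      coev_counit_assoc, leftUnitor_inv_actionHom])

theorem counit_comp (x : M) :
    comp C n n x ≫ (icoHom C n).obj x ◁ counit C n = (ρ_ _).inv :=
  hom_ext (by
    have h := congrArg ((icoHom C n).obj x ⊴ₗ ·) (coev_counit C n)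
    simp only [actionHomRight_comp] at h
    simp [reassoc_of% h, rightUnitor_inv_actionHom])

end icoHom

/-- The internal coendomorphism object `C_n = icoHom(n, n)`. -/
noncomputable def icoEnd (n : M) [(actionRight C n).IsRightAdjoint] : C := (icoHom C n).obj n

variable (n : M) [(actionRight C n).IsRightAdjoint]

/-- The coalgebra structure on `C_n = icoHom(n, n)`. -/
noncomputable instance : ComonObj (icoEnd C n) where
  counit := icoHom.counit C n
  comul := icoHom.comp C n n n
  counit_comul := icoHom.comp_counit C n n
  comul_counit := icoHom.counit_comp C n n
  comul_assoc := icoHom.comp_assoc C n n n n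

/-- The right `C_n`-comodule `icoHom(n, x)`. -/
@[simps]
noncomputable def icoHomComodObj (x : M) : RightComod (icoEnd C n) where
  X := (icoHom C n).obj x
  coact := icoHom.comp C n n x
  coact_counit := icoHom.counit_comp C n x
  coact_comul := icoHom.comp_assoc C n n n x

/-- The functor `icoHom(n, -) : M ⥤ comod-C_n`. -/
@[simps]
noncomputable def icoHomComod : M ⥤ RightComod (icoEnd C n) where
  obj x := icoHomComodObj C n x
  map f := ⟨(icoHom C n).map f, icoHom.map_comp C n n f⟩
  map_id x := RightComod.hom_ext _ _ ((icoHom C n).map_id x)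
  map_comp f g := RightComod.hom_ext _ _ ((icoHom C n).map_comp f g)

/-- The canonical oplax module functor structure on `icoHom(n, -) : M ⥤ comod-C_n`. -/
noncomputable instance icoHomComod.oplaxLeftLinear : (icoHomComod C n).OplaxLeftLinear C where
  δₗ c x := ⟨icoHom.colineator C n c x, icoHom.colineator_comp C n n c x⟩
  δₗ_naturality_left f x := RightComod.hom_ext _ _
    (Functor.OplaxLeftLinear.δₗ_naturality_left (icoHom C n) f x)
  δₗ_naturality_right c _ _ f := RightComod.hom_ext _ _
    (Functor.OplaxLeftLinear.δₗ_naturality_right (icoHom C n) c f)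
  δₗ_associativity c c' x := RightComod.hom_ext _ _
    (Functor.OplaxLeftLinear.δₗ_associativity (icoHom C n) c c' x)
  δₗ_unitality_inv x := RightComod.hom_ext _ _
    (Functor.OplaxLeftLinear.δₗ_unitality_inv (C := C) (icoHom C n) x)

end InternalCoHom



/-- A Grothendieck-Verdier structure on a monoidal category: a dualizing object `K`, together with
an anti-equivalence `G` and bijections `Hom(x ⊗ y, K) ≃ Hom(x, G y)` natural in `x` and `y`. -/
class GVCategory (C : Type u₁) [Category.{v₁} C] [MonoidalCategory C] where
  /-- the dualizing object -/
  K : C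
  /-- the duality functor, as an anti-equivalence -/
  G : Cᵒᵖ ≌ C
  /-- the representing bijections -/
  homEquiv (x y : C) : (x ⊗ y ⟶ K) ≃ (x ⟶ G.functor.obj (Opposite.op y))
  homEquiv_naturality_left {x x' : C} (f : x' ⟶ x) {y : C} (h : x ⊗ y ⟶ K) :
    homEquiv x' y (f ▷ y ≫ h) = f ≫ homEquiv x y h
  homEquiv_naturality_right (x : C) {y y' : C} (f : y' ⟶ y) (h : x ⊗ y ⟶ K) :
    homEquiv x y' (x ◁ f ≫ h) = homEquiv x y h ≫ G.functor.map f.op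

section Par

open Opposite

variable {C : Type u₁} [Category.{v₁} C] [MonoidalCategory C] [GVCategory C]

/-- `G` on objects. -/
abbrev gObj (x : C) : C := (GVCategory.G (C := C)).functor.obj (op x)

/-- `G` on morphisms. -/
abbrev gMap {x y : C} (f : x ⟶ y) : gObj y ⟶ gObj x := (GVCategory.G (C := C)).functor.map f.op

/-- `G⁻¹` on objects. -/
abbrev gInvObj (x : C) : C := ((GVCategory.G (C := C)).inverse.obj x).unop

/-- `G⁻¹` on morphisms. -/
abbrev gInvMap {x y : C} (f : x ⟶ y) : gInvObj y ⟶ gInvObj x :=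
  ((GVCategory.G (C := C)).inverse.map f).unop

/-- The isomorphism `G (G⁻¹ x) ≅ x`. -/
abbrev gGInv (x : C) : gObj (gInvObj x) ≅ x := (GVCategory.G (C := C)).counitIso.app x

theorem gMap_gInvMap {x y : C} (f : x ⟶ y) :
    gMap (gInvMap f) = (gGInv x).hom ≫ f ≫ (gGInv y).inv := by
  simp [gMap, gInvMap]

@[simp]
theorem gMap_id (x : C) : gMap (𝟙 x) = 𝟙 (gObj x) :=
  (GVCategory.G (C := C)).functor.map_id (op x)

theorem gMap_comp {x y z : C} (f : x ⟶ y) (h : y ⟶ z) : gMap (f ≫ h) = gMap h ≫ gMap f :=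
  (GVCategory.G (C := C)).functor.map_comp h.op f.op

theorem gMap_injective {x y : C} : Function.Injective (gMap (C := C) (x := x) (y := y)) :=
  fun _ _ e =>
  Quiver.Hom.op_inj ((GVCategory.G (C := C)).functor.map_injective e)

/-- The isomorphism `x ≅ y` with `G`-image a given isomorphism `G y ≅ G x`. -/
noncomputable def gPreimageIso {x y : C} (e : gObj y ≅ gObj x) : x ≅ y :=
  ((GVCategory.G (C := C)).functor.preimageIso e).unop

@[simp]
theorem gMap_gPreimageIso_hom {x y : C} (e : gObj y ≅ gObj x) :
    gMap (gPreimageIso e).hom = e.hom := by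
  simp [gMap, gPreimageIso]

theorem bijective_homEquiv_leftUnitor_comp (z : C) : Function.Bijective
    (fun h : gObj (GVCategory.K (C := C)) ⟶ z =>
      GVCategory.homEquiv (𝟙_ C) GVCategory.K (λ_ _).hom ≫ h) := by
  have key (y : C) (f : y ⟶ GVCategory.K) :
      GVCategory.homEquiv (𝟙_ C) GVCategory.K (λ_ _).hom ≫ gMap f =
        GVCategory.homEquiv (𝟙_ C) y ((λ_ y).hom ≫ f) := by
    rw [← GVCategory.homEquiv_naturality_right, leftUnitor_naturality]
  have hy (y : C) : Function.Bijective (fun h : gObj (GVCategory.K (C := C)) ⟶ gObj y =>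
      GVCategory.homEquiv (𝟙_ C) GVCategory.K (λ_ _).hom ≫ h) := by
    constructor
    · intro a b hab
      obtain ⟨a, rfl⟩ := (GVCategory.G (C := C)).functor.map_surjective a
      obtain ⟨b, rfl⟩ := (GVCategory.G (C := C)).functor.map_surjective b
      have := ((key y a.unop).symm.trans hab).trans (key y b.unop)
      have := (cancel_epi _).mp ((GVCategory.homEquiv _ _).injective this)
      rw [Quiver.Hom.unop_inj this]
    · intro b
      refine ⟨gMap ((λ_ y).inv ≫ (GVCategory.homEquiv _ _).symm b), ?_⟩
      refine (key _ _).trans ?_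
      simp
  let e := gGInv z
  constructor
  · intro a b hab
    have := (hy (gInvObj z)).1 (a₁ := a ≫ e.inv) (a₂ := b ≫ e.inv) (by
      simpa using congrArg (· ≫ e.inv) hab)
    exact (cancel_mono _).mp this
  · intro b
    obtain ⟨a, ha⟩ := (hy (gInvObj z)).2 (b ≫ e.inv)
    refine ⟨a ≫ e.hom, ?_⟩
    have := congrArg (· ≫ e.hom) ha
    simpa using this

instance : IsIso (GVCategory.homEquiv (𝟙_ C) (GVCategory.K (C := C)) (λ_ _).hom) :=
  isIso_of_coyoneda_map_bijective _ bijective_homEquiv_leftUnitor_comp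

/-- The canonical isomorphism `G K ≅ 𝟙`. -/
noncomputable def gUnitIso : gObj (GVCategory.K (C := C)) ≅ 𝟙_ C :=
  (asIso (GVCategory.homEquiv (𝟙_ C) (GVCategory.K (C := C)) (λ_ _).hom)).symm

/-- The second tensor product: `par x y = G⁻¹ (G y ⊗ G x)`. -/
abbrev par (x y : C) : C := gInvObj (gObj y ⊗ gObj x)

/-- The isomorphism `G (par x y) ≅ G y ⊗ G x`. -/
abbrev gPar (x y : C) : gObj (par x y) ≅ gObj y ⊗ gObj x := gGInv _

/-- The second tensor product on morphisms. -/
abbrev parMap {x y x' y' : C} (f : x ⟶ x') (h : y ⟶ y') : par x y ⟶ par x' y' :=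
  gInvMap (gMap h ⊗ₘ gMap f)

/-- The associator of the second tensor product: it is induced by
`α : (G z ⊗ G y) ⊗ G x ≅ G z ⊗ (G y ⊗ G x)`. -/
noncomputable def parAssoc (x y z : C) : par (par x y) z ≅ par x (par y z) :=
  gPreimageIso (gPar x (par y z) ≪≫ whiskerRightIso (gPar y z) (gObj x) ≪≫
    α_ (gObj z) (gObj y) (gObj x) ≪≫ whiskerLeftIso (gObj z) (gPar x y).symm ≪≫
    (gPar (par x y) z).symm)

/-- The left unitor of the second tensor product: it is induced by `ρ : G x ⊗ 𝟙 ≅ G x`. -/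
noncomputable def parLeftUnitor (x : C) : par GVCategory.K x ≅ x :=
  gPreimageIso ((ρ_ (gObj x)).symm ≪≫ whiskerLeftIso (gObj x) gUnitIso.symm ≪≫
    (gPar GVCategory.K x).symm)

/-- The right unitor of the second tensor product: it is induced by `λ : 𝟙 ⊗ G x ≅ G x`. -/
noncomputable def parRightUnitor (x : C) : par x GVCategory.K ≅ x :=
  gPreimageIso ((λ_ (gObj x)).symm ≪≫ whiskerRightIso gUnitIso.symm (gObj x) ≪≫
    (gPar x GVCategory.K).symm)

theorem gMap_parMap {x y x' y' : C} (f : x ⟶ x') (h : y ⟶ y') :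
    gMap (parMap f h) = ((gPar x' y').hom ≫ (gMap h ⊗ₘ gMap f)) ≫ (gPar x y).inv := by
  rw [gMap_gInvMap, Category.assoc]

theorem gMap_whiskerLeft (x : C) {y y' : C} (h : y ⟶ y') :
    gMap (parMap (𝟙 x) h) = ((gPar x y').hom ≫ gMap h ▷ gObj x) ≫ (gPar x y).inv := by
  rw [gMap_parMap, gMap_id, tensorHom_id]

theorem gMap_whiskerRight {x x' : C} (f : x ⟶ x') (y : C) :
    gMap (parMap f (𝟙 y)) = ((gPar x' y).hom ≫ gObj y ◁ gMap f) ≫ (gPar x y).inv := by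
  rw [gMap_parMap, gMap_id, id_tensorHom]

theorem gMap_parAssoc (x y z : C) :
    gMap (parAssoc x y z).hom = (((gPar x (par y z)).hom ≫ ((gPar y z).hom ⊗ₘ 𝟙 (gObj x))) ≫
      (α_ (gObj z) (gObj y) (gObj x)).hom) ≫ (𝟙 (gObj z) ⊗ₘ (gPar x y).inv) ≫
        (gPar (par x y) z).inv := by
  simp [parAssoc]

theorem gMap_parLeftUnitor (x : C) :
    gMap (parLeftUnitor x).hom = (ρ_ (gObj x)).inv ≫ (𝟙 (gObj x) ⊗ₘ gUnitIso.inv) ≫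
    (gPar GVCategory.K x).inv := by
  simp [parLeftUnitor]

theorem gMap_parRightUnitor (x : C) :
    gMap (parRightUnitor x).hom = (λ_ (gObj x)).inv ≫ (gUnitIso.inv ⊗ₘ 𝟙 (gObj x)) ≫
    (gPar x GVCategory.K).inv := by
  simp [parRightUnitor]

variable (C) in
/-- The category `C`, regarded as a monoidal category via its second tensor product. -/
def Par : Type u₁ := C

instance : Category.{v₁} (Par C) := inferInstanceAs (Category.{v₁} C)

noncomputable instance : MonoidalCategoryStruct (Par C) where
  tensorObj x y := par (C := C) x y
  whiskerLeft x _ _ f := parMap (C := C) (𝟙 x) f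
  whiskerRight f y := parMap (C := C) f (𝟙 y)
  tensorHom f h := parMap (C := C) f h
  tensorUnit := GVCategory.K (C := C)
  associator x y z := parAssoc (C := C) x y z
  leftUnitor x := parLeftUnitor (C := C) x
  rightUnitor x := parRightUnitor (C := C) x

variable (C) in
/-- The duality functor, as a functor from `C` to the opposite category with reversed tensor
product. -/
def gFunctor : Par C ⥤ (Cᵒᵖ)ᴹᵒᵖ where
  obj x := MonoidalOpposite.mop (op (gObj (C := C) x))
  map f := (gMap (C := C) f).op.mop
  map_id x := by
    apply Quiver.Hom.unmop_inj
    apply Quiver.Hom.unop_inj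
    exact (GVCategory.G (C := C)).functor.map_id (op x)
  map_comp f h := by
    apply Quiver.Hom.unmop_inj
    apply Quiver.Hom.unop_inj
    exact (GVCategory.G (C := C)).functor.map_comp (Quiver.Hom.op (V := C) h) (Quiver.Hom.op (V := C) f)

instance : (gFunctor C).Faithful where
  map_injective h := gMap_injective (C := C) (Quiver.Hom.op_inj (Quiver.Hom.mop_inj h))

/-- The data exhibiting the second tensor product as induced by the functor `gFunctor`. -/
noncomputable def gFunctorData : Monoidal.InducingFunctorData (gFunctor C) where
  μIso x y := ((gPar (C := C) x y).op).mop
  whiskerLeft_eq x _ _ f := Quiver.Hom.unmop_inj (Quiver.Hom.unop_inj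
    (gMap_whiskerLeft (C := C) x f))
  whiskerRight_eq f y := Quiver.Hom.unmop_inj (Quiver.Hom.unop_inj
    (gMap_whiskerRight (C := C) f y))
  tensorHom_eq f h := Quiver.Hom.unmop_inj (Quiver.Hom.unop_inj
    (gMap_parMap (C := C) f h))
  εIso := ((gUnitIso (C := C)).op).mop
  associator_eq x y z := Quiver.Hom.unmop_inj (Quiver.Hom.unop_inj
    (gMap_parAssoc (C := C) x y z))
  leftUnitor_eq x := Quiver.Hom.unmop_inj (Quiver.Hom.unop_inj
    (gMap_parLeftUnitor (C := C) x))
  rightUnitor_eq x := Quiver.Hom.unmop_inj (Quiver.Hom.unop_inj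
    (gMap_parRightUnitor (C := C) x))

/-- The monoidal category `(C, par, K)`. -/
noncomputable instance : MonoidalCategory (Par C) := Monoidal.induced (gFunctor C) gFunctorData

end Par

section HAct

variable {C : Type u₁} [Category.{v₁} C] [MonoidalCategory C]
  {M : Type u₂} [Category.{v₂} M] [MonoidalLeftAction C M]
  [∀ c : C, (actionLeft M c).IsLeftAdjoint]

/-- The chosen right adjoint `H_c` of `c ▷ -`. -/
noncomputable def hAct (c : C) : M ⥤ M := (actionLeft M c).rightAdjoint

/-- The defining adjunction of `H_c`. -/
noncomputable def hAdj (c : C) : actionLeft M c ⊣ hAct c := Adjunction.ofIsLeftAdjoint _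

/-- The adjunction bijection `Hom(c ▷ y, x) → Hom(y, H_c x)`. -/
noncomputable def hLift {c : C} {x y : M} (f : c ⊙ₗ y ⟶ x) : y ⟶ (hAct c).obj x :=
  (hAdj c).homEquiv y x f

/-- The adjunction bijection `Hom(y, H_c x) → Hom(c ▷ y, x)`. -/
noncomputable def hUnlift {c : C} {x y : M} (f : y ⟶ (hAct c).obj x) : c ⊙ₗ y ⟶ x :=
  ((hAdj c).homEquiv y x).symm f

theorem hUnlift_hLift {c : C} {x y : M} (f : c ⊙ₗ y ⟶ x) : hUnlift (hLift f) = f :=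
  ((hAdj c).homEquiv y x).symm_apply_apply f

theorem hLift_hUnlift {c : C} {x y : M} (f : y ⟶ (hAct c).obj x) : hLift (hUnlift f) = f :=
  ((hAdj c).homEquiv y x).apply_symm_apply f

theorem hUnlift_inj {c : C} {x y : M} {f g : y ⟶ (hAct c).obj x} (h : hUnlift f = hUnlift g) :
    f = g :=
  ((hAdj c).homEquiv y x).symm.injective h

theorem hUnlift_comp {c : C} {x y z : M} (g : z ⟶ y) (f : y ⟶ (hAct c).obj x) :
    hUnlift (g ≫ f) = c ⊴ₗ g ≫ hUnlift f :=
  (hAdj c).homEquiv_naturality_left_symm g f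

theorem hUnlift_comp_hLift {c : C} {x y z : M} (g : z ⟶ y) (f : c ⊙ₗ y ⟶ x) :
    hUnlift (g ≫ hLift f) = c ⊴ₗ g ≫ f := by
  rw [hUnlift_comp, hUnlift_hLift]

theorem hUnlift_comp_map {c : C} {x x' y : M} (f : y ⟶ (hAct c).obj x) (g : x ⟶ x') :
    hUnlift (f ≫ (hAct c).map g) = hUnlift f ≫ g :=
  (hAdj c).homEquiv_naturality_right_symm f g

/-- The morphism `H_{c'} x ⟶ H_c x` induced by `f : c ⟶ c'`. -/
noncomputable def hPre {c c' : C} (f : c ⟶ c') (x : M) : (hAct c').obj x ⟶ (hAct c).obj x :=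
  hLift (f ⊵ₗ _ ≫ hUnlift (𝟙 _))

theorem hUnlift_comp_hPre {c c' : C} (f : c ⟶ c') {x y : M} (g : y ⟶ (hAct c').obj x) :
    hUnlift (g ≫ hPre f x) = f ⊵ₗ y ≫ hUnlift g := by
  rw [hPre, hUnlift_comp_hLift, action_exchange_assoc, ← hUnlift_comp, Category.comp_id]

theorem comp_ext {D : Type u₂} [Category.{v₂} D] {x y : D} {f g : x ⟶ y}
    (h : ∀ (z : D) (k : z ⟶ x), k ≫ f = k ≫ g) : f = g := by
  simpa using h x (𝟙 x)

theorem hPre_id (c : C) (x : M) : hPre (𝟙 c) x = 𝟙 _ :=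
  comp_ext fun _ k => hUnlift_inj (by simp [hUnlift_comp_hPre])

theorem hPre_comp {c c' c'' : C} (f : c ⟶ c') (g : c' ⟶ c'') (x : M) :
    hPre (f ≫ g) x = hPre g x ≫ hPre f x :=
  comp_ext fun _ k => hUnlift_inj (by
    rw [← Category.assoc, hUnlift_comp_hPre, hUnlift_comp_hPre, hUnlift_comp_hPre,
      comp_actionHomLeft, Category.assoc])

theorem hPre_naturality {c c' : C} (f : c ⟶ c') {x y : M} (g : x ⟶ y) :
    hPre f x ≫ (hAct c).map g = (hAct c').map g ≫ hPre f y :=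
  comp_ext fun _ k => hUnlift_inj (by
    rw [← Category.assoc, ← Category.assoc, hUnlift_comp_map, hUnlift_comp_hPre,
      hUnlift_comp_hPre, hUnlift_comp_map, Category.assoc])

/-- `H_{c'} x ≅ H_c x` for `c ≅ c'`. -/
@[simps]
noncomputable def hPreIso {c c' : C} (e : c ≅ c') (x : M) : (hAct c').obj x ≅ (hAct c).obj x where
  hom := hPre e.hom x
  inv := hPre e.inv x
  hom_inv_id := by rw [← hPre_comp, e.inv_hom_id, hPre_id]
  inv_hom_id := by rw [← hPre_comp, e.hom_inv_id, hPre_id]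

/-- The morphism `H_{c ⊗ d} x ⟶ H_d (H_c x)`. -/
noncomputable def hAssocHom (c d : C) (x : M) :
    (hAct (c ⊗ d)).obj x ⟶ (hAct d).obj ((hAct c).obj x) :=
  hLift (hLift ((αₗ c d _).inv ≫ hUnlift (𝟙 _)))

/-- The morphism `H_d (H_c x) ⟶ H_{c ⊗ d} x`. -/
noncomputable def hAssocInv (c d : C) (x : M) :
    (hAct d).obj ((hAct c).obj x) ⟶ (hAct (c ⊗ d)).obj x :=
  hLift ((αₗ c d _).hom ≫ hUnlift (hUnlift (𝟙 _)))

theorem hUnlift_comp_hAssocHom {c d : C} {x y : M} (g : y ⟶ (hAct (c ⊗ d)).obj x) :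
    hUnlift (hUnlift (g ≫ hAssocHom c d x)) = (αₗ c d y).inv ≫ hUnlift g := by
  have h := actionAssocIso_inv_naturality (𝟙 c) (𝟙 d) g
  simp only [id_actionHom, id_tensorHom_id] at h
  rw [hAssocHom, hUnlift_comp_hLift, hUnlift_comp_hLift, ← Category.assoc, h, Category.assoc,
    ← hUnlift_comp, Category.comp_id]

theorem hUnlift_comp_hAssocInv {c d : C} {x y : M} (g : y ⟶ (hAct d).obj ((hAct c).obj x)) :
    hUnlift (g ≫ hAssocInv c d x) = (αₗ c d y).hom ≫ hUnlift (hUnlift g) := by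
  have h := actionAssocIso_hom_naturality (𝟙 c) (𝟙 d) g
  simp only [id_actionHom, id_tensorHom_id] at h
  rw [hAssocInv, hUnlift_comp_hLift, ← Category.assoc, h, Category.assoc,
    ← hUnlift_comp, ← hUnlift_comp, Category.comp_id]

/-- The isomorphism `H_{c ⊗ d} x ≅ H_d (H_c x)`. -/
@[simps]
noncomputable def hAssocIso (c d : C) (x : M) :
    (hAct (c ⊗ d)).obj x ≅ (hAct d).obj ((hAct c).obj x) where
  hom := hAssocHom c d x
  inv := hAssocInv c d x
  hom_inv_id := comp_ext fun _ k => hUnlift_inj (by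
    rw [← Category.assoc, hUnlift_comp_hAssocInv, hUnlift_comp_hAssocHom]
    simp)
  inv_hom_id := comp_ext fun _ k => hUnlift_inj (hUnlift_inj (by
    rw [← Category.assoc, hUnlift_comp_hAssocHom, hUnlift_comp_hAssocInv]
    simp))

/-- The isomorphism `H_𝟙 x ≅ x`. -/
noncomputable def hUnitIso (x : M) : (hAct (𝟙_ C)).obj x ≅ x where
  hom := (λₗ _).inv ≫ hUnlift (𝟙 _)
  inv := hLift (λₗ x).hom
  hom_inv_id := hUnlift_inj (by
    rw [hUnlift_comp_hLift, ← actionUnitIso_hom_naturality]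
    simp)
  inv_hom_id := by
    rw [← Category.assoc, ← actionUnitIso_inv_naturality, Category.assoc, ← hUnlift_comp,
      Category.comp_id, hUnlift_hLift, Iso.inv_hom_id]

theorem comp_hUnitIso_hom {x y : M} (g : y ⟶ (hAct (𝟙_ C)).obj x) :
    g ≫ (hUnitIso x).hom = (λₗ y).inv ≫ hUnlift g := by
  change g ≫ (λₗ _).inv ≫ hUnlift (𝟙 _) = _
  rw [← Category.assoc, ← actionUnitIso_inv_naturality, Category.assoc, ← hUnlift_comp,
      Category.comp_id]

theorem hAssocHom_naturality {c c' d d' : C} (f : c ⟶ c') (g : d ⟶ d') {x y : M} (k : x ⟶ y) :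
    (hPre (f ⊗ₘ g) x ≫ (hAct (c ⊗ d)).map k) ≫ hAssocHom c d y =
      hAssocHom c' d' x ≫ hPre g _ ≫ (hAct d).map (hPre f x ≫ (hAct c).map k) :=
  comp_ext fun z l => hUnlift_inj (hUnlift_inj (by
    have h := actionAssocIso_inv_naturality f g (𝟙 z)
    simp only [actionHom_id] at h
    simp only [actionHom_def, Category.assoc] at h
    simp only [← Category.assoc, hUnlift_comp_hAssocHom, hUnlift_comp_map, hUnlift_comp_hPre]
    rw [← h, hUnlift_comp]
    simp only [Category.assoc, hUnlift_comp_hAssocHom]))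

theorem hAssocHom_whiskerLeft (c : C) {d d' : C} (f : d ⟶ d') (x : M) :
    hPre (c ◁ f) x ≫ hAssocHom c d x = hAssocHom c d' x ≫ hPre f _ := by
  have h := hAssocHom_naturality (𝟙 c) f (𝟙 x)
  simpa [hPre_id] using h

theorem hAssocHom_whiskerRight {c c' : C} (f : c ⟶ c') (d : C) (x : M) :
    hPre (f ▷ d) x ≫ hAssocHom c d x = hAssocHom c' d x ≫ (hAct d).map (hPre f x) := by
  have h := hAssocHom_naturality f (𝟙 d) (𝟙 x)
  simpa [hPre_id] using h

theorem hAssocHom_map (c d : C) {x y : M} (k : x ⟶ y) :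
    (hAct (c ⊗ d)).map k ≫ hAssocHom c d y =
      hAssocHom c d x ≫ (hAct d).map ((hAct c).map k) := by
  have h := hAssocHom_naturality (𝟙 c) (𝟙 d) k
  simpa [hPre_id] using h

theorem hAssocHom_associator (a b c : C) (x : M) :
    hPre (α_ a b c).hom x ≫ hAssocHom (a ⊗ b) c x ≫ (hAct c).map (hAssocHom a b x) =
      hAssocHom a (b ⊗ c) x ≫ hAssocHom b c _ :=
  comp_ext fun z l => hUnlift_inj (hUnlift_inj (hUnlift_inj (by
    rw [← Category.assoc, ← Category.assoc, ← Category.assoc, hUnlift_comp_map,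
      hUnlift_comp_hAssocHom, hUnlift_comp_hAssocHom, hUnlift_comp_hAssocHom, hUnlift_comp_hPre,
      hUnlift_comp, hUnlift_comp_hAssocHom]
    rw [← cancel_epi (a ⊴ₗ (αₗ b c z).hom), ← cancel_epi (αₗ a (b ⊗ c) z).hom,
      ← cancel_epi ((α_ a b c).hom ⊵ₗ z), associator_actionHom_assoc]
    simp)))

theorem hUnitIso_naturality {x y : M} (f : x ⟶ y) :
    (hUnitIso (C := C) x).hom ≫ f = (hAct (𝟙_ C)).map f ≫ (hUnitIso y).hom :=
  comp_ext fun z l => by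
    rw [← Category.assoc, ← Category.assoc, comp_hUnitIso_hom, comp_hUnitIso_hom,
      hUnlift_comp_map, Category.assoc]

theorem hUnit_rightUnitor (c : C) (x : M) :
    hPre (ρ_ c).hom x ≫ hAssocHom c (𝟙_ C) x ≫ (hUnitIso _).hom = 𝟙 _ :=
  comp_ext fun z l => hUnlift_inj (by
    rw [← Category.assoc, ← Category.assoc, comp_hUnitIso_hom, hUnlift_comp,
      hUnlift_comp_hAssocHom, hUnlift_comp_hPre, rightUnitor_actionHom]
    simp)

theorem hUnit_leftUnitor (c : C) (x : M) :
    hPre (λ_ c).hom x ≫ hAssocHom (𝟙_ C) c x ≫ (hAct c).map (hUnitIso x).hom = 𝟙 _ :=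
  comp_ext fun z l => hUnlift_inj (by
    rw [← Category.assoc, ← Category.assoc, hUnlift_comp_map, comp_hUnitIso_hom,
      hUnlift_comp_hAssocHom, hUnlift_comp_hPre, leftUnitor_actionHom]
    simp)

end HAct

/-- A module category over a GV-category `C` such that all functors `c ▷ -` and `- ▷ m` have a
right adjoint. -/
class GVModule (C : Type u₁) [Category.{v₁} C] [MonoidalCategory C] [GVCategory C]
    (M : Type u₂) [Category.{v₂} M] [MonoidalLeftAction C M] : Prop where
  actionLeft_isLeftAdjoint (c : C) : (actionLeft M c).IsLeftAdjoint
  actionRight_isLeftAdjoint (m : M) : (actionRight C m).IsLeftAdjoint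

attribute [instance] GVModule.actionLeft_isLeftAdjoint GVModule.actionRight_isLeftAdjoint

section ParAction

open Opposite

variable {C : Type u₁} [Category.{v₁} C] [MonoidalCategory C] [GVCategory C]
  {M : Type u₂} [Category.{v₂} M] [MonoidalLeftAction C M] [GVModule C M]

/-- The associativity constraint `(b par c) ◁̃ x ≅ b ◁̃ (c ◁̃ x)`. -/
noncomputable def parActionAssoc (b c : C) (x : M) :
    (hAct (gObj (par b c))).obj x ≅ (hAct (gObj b)).obj ((hAct (gObj c)).obj x) :=
  hPreIso (gPar b c).symm x ≪≫ hAssocIso (gObj c) (gObj b) x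

/-- The unit constraint `K ◁̃ x ≅ x`. -/
noncomputable def parActionUnit (x : M) : (hAct (gObj (GVCategory.K (C := C)))).obj x ≅ x :=
  hPreIso gUnitIso.symm x ≪≫ hUnitIso x

theorem parActionAssoc_hom (b c : C) (x : M) :
    (parActionAssoc b c x).hom = hPre (gPar b c).inv x ≫ hAssocHom (gObj c) (gObj b) x := rfl

theorem parActionUnit_hom (x : M) :
    (parActionUnit (C := C) x).hom = hPre gUnitIso.inv x ≫ (hUnitIso x).hom := rfl

theorem parAction_id (c : C) (x : M) : hPre (gMap (𝟙 c)) x = 𝟙 _ := by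
  rw [gMap_id, hPre_id]

theorem parAction_comp {c₁ c₂ c₃ : C} (f₁ : c₁ ⟶ c₂) (f₂ : c₂ ⟶ c₃) {x y z : M} (g₁ : x ⟶ y)
    (g₂ : y ⟶ z) :
    hPre (gMap (f₁ ≫ f₂)) x ≫ (hAct (gObj c₃)).map (g₁ ≫ g₂) =
      (hPre (gMap f₁) x ≫ (hAct (gObj c₂)).map g₁) ≫
        hPre (gMap f₂) y ≫ (hAct (gObj c₃)).map g₂ := by
  rw [gMap_comp, hPre_comp, Functor.map_comp, Category.assoc, Category.assoc,
    ← Category.assoc ((hAct _).map g₁), ← hPre_naturality, Category.assoc]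

theorem parActionAssoc_naturality {b b' c c' : C} (f : b ⟶ b') (g : c ⟶ c') {x y : M}
    (k : x ⟶ y) :
    (hPre (gMap (parMap f g)) x ≫ (hAct (gObj (par b' c'))).map k) ≫
        (parActionAssoc b' c' y).hom =
      (parActionAssoc b c x).hom ≫ hPre (gMap f) _ ≫
        (hAct (gObj b')).map (hPre (gMap g) x ≫ (hAct (gObj c')).map k) := by
  have h₁ : hPre (gPar b' c').hom x ≫ hPre (gPar b' c').inv x = 𝟙 _ := by
    rw [← hPre_comp, Iso.inv_hom_id, hPre_id]
  have h₂ := hPre_naturality (gPar b' c').inv k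
  have h₃ := hAssocHom_naturality (gMap g) (gMap f) k
  simp only [Category.assoc] at h₃
  simp only [gMap_parMap, parActionAssoc_hom, hPre_comp, Category.assoc]
  rw [← h₃, ← reassoc_of% h₂, reassoc_of% h₁]

theorem parActionUnit_naturality {x y : M} (f : x ⟶ y) :
    (parActionUnit (C := C) x).hom ≫ f =
      (hAct (gObj (GVCategory.K (C := C)))).map f ≫ (parActionUnit y).hom := by
  rw [parActionUnit_hom, parActionUnit_hom, Category.assoc, hUnitIso_naturality,
    ← Category.assoc, hPre_naturality, Category.assoc]

theorem parAction_whiskerLeft (b : C) {c c' : C} (f : c ⟶ c') (x : M) :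
    hPre (gMap (parMap (𝟙 b) f)) x = (parActionAssoc b c x).hom ≫
      (hAct (gObj b)).map (hPre (gMap f) x) ≫ (parActionAssoc b c' x).inv := by
  rw [← Category.assoc, Iso.eq_comp_inv]
  have h := parActionAssoc_naturality (𝟙 b) f (𝟙 x)
  simpa [hPre_id] using h

theorem parAction_whiskerRight {b b' : C} (f : b ⟶ b') (c : C) (x : M) :
    hPre (gMap (parMap f (𝟙 c))) x = (parActionAssoc b c x).hom ≫
      hPre (gMap f) ((hAct (gObj c)).obj x) ≫ (parActionAssoc b' c x).inv := by
  rw [← Category.assoc, Iso.eq_comp_inv]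
  have h := parActionAssoc_naturality f (𝟙 c) (𝟙 x)
  simpa [hPre_id] using h

theorem parAction_associator (a b c : C) (x : M) :
    hPre (gMap (parAssoc a b c).hom) x ≫ (parActionAssoc a (par b c) x).hom ≫
        (hAct (gObj a)).map (parActionAssoc b c x).hom =
      (parActionAssoc (par a b) c x).hom ≫ (parActionAssoc a b _).hom := by
  have h₁ : hPre (gPar a (par b c)).hom x ≫ hPre (gPar a (par b c)).inv x = 𝟙 _ := by
    rw [← hPre_comp, Iso.inv_hom_id, hPre_id]
  have h₂ : hPre ((gPar b c).hom ▷ gObj a) x ≫ hPre ((gPar b c).inv ▷ gObj a) x = 𝟙 _ := by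
    rw [← hPre_comp, inv_hom_whiskerRight, hPre_id]
  have h₃ := hAssocHom_whiskerRight (gPar b c).inv (gObj a) x
  have h₄ := hAssocHom_associator (gObj c) (gObj b) (gObj a) x
  have h₅ := hAssocHom_whiskerLeft (gObj c) (gPar a b).inv x
  simp only [gMap_parAssoc, parActionAssoc_hom, hPre_comp, Functor.map_comp, Category.assoc,
    tensorHom_id, id_tensorHom]
  rw [reassoc_of% h₁, ← reassoc_of% h₃, reassoc_of% h₂, h₄, reassoc_of% h₅]

theorem parAction_leftUnitor (c : C) (x : M) :
    hPre (gMap (parLeftUnitor c).hom) x = (parActionAssoc GVCategory.K c x).hom ≫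
      (parActionUnit (C := C) _).hom := by
  have h₁ := hAssocHom_whiskerLeft (gObj c) (gUnitIso (C := C)).inv x
  have h₂ := hUnit_rightUnitor (gObj c) x
  have h₃ : hPre (ρ_ (gObj c)).inv x ≫ hPre (ρ_ (gObj c)).hom x = 𝟙 _ := by
    rw [← hPre_comp, Iso.hom_inv_id, hPre_id]
  simp only [gMap_parLeftUnitor, parActionAssoc_hom, parActionUnit_hom, hPre_comp,
    Category.assoc, id_tensorHom]
  rw [← reassoc_of% h₁]
  have h₄ : hPre (ρ_ (gObj c)).inv x = hAssocHom (gObj c) (𝟙_ C) x ≫ (hUnitIso _).hom := by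
    have := congrArg (hPre (ρ_ (gObj c)).inv x ≫ ·) h₂
    simpa [reassoc_of% h₃] using this.symm
  rw [h₄]

theorem parAction_rightUnitor (c : C) (x : M) :
    hPre (gMap (parRightUnitor c).hom) x = (parActionAssoc c GVCategory.K x).hom ≫
      (hAct (gObj c)).map (parActionUnit (C := C) x).hom := by
  have h₁ := hAssocHom_whiskerRight (gUnitIso (C := C)).inv (gObj c) x
  have h₂ := hUnit_leftUnitor (gObj c) x
  have h₃ : hPre (λ_ (gObj c)).inv x ≫ hPre (λ_ (gObj c)).hom x = 𝟙 _ := by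
    rw [← hPre_comp, Iso.hom_inv_id, hPre_id]
  simp only [gMap_parRightUnitor, parActionAssoc_hom, parActionUnit_hom, hPre_comp,
    Functor.map_comp, Category.assoc, tensorHom_id]
  rw [← reassoc_of% h₁]
  have h₄ : hPre (λ_ (gObj c)).inv x =
      hAssocHom (𝟙_ C) (gObj c) x ≫ (hAct (gObj c)).map (hUnitIso x).hom := by
    have := congrArg (hPre (λ_ (gObj c)).inv x ≫ ·) h₂
    simpa [reassoc_of% h₃] using this.symm
  rw [h₄]

/-- The second action `c ◁̃ x = H_{G c} x` of `(C, par, K)` on a GV-module category. -/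
noncomputable instance parAction : MonoidalLeftAction (Par C) M where
  actionObj c x := (hAct (gObj (C := C) c)).obj x
  actionHomLeft f x := hPre (gMap (C := C) f) x
  actionHomRight c _ _ f := (hAct (gObj (C := C) c)).map f
  actionAssocIso b c x := parActionAssoc (C := C) b c x
  actionUnitIso x := parActionUnit (C := C) x
  actionHom_def _ _ := rfl
  actionHomRight_id c x := (hAct (gObj (C := C) c)).map_id x
  id_actionHomLeft c x := parAction_id (C := C) c x
  actionHom_comp f₁ f₂ g₁ g₂ := parAction_comp (C := C) f₁ f₂ g₁ g₂
  actionAssocIso_hom_naturality f g k := parActionAssoc_naturality (C := C) f g k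
  actionUnitIso_hom_naturality f := parActionUnit_naturality (C := C) f
  whiskerLeft_actionHomLeft b _ _ f x := parAction_whiskerLeft (C := C) b f x
  whiskerRight_actionHomLeft c f x := parAction_whiskerRight (C := C) f c x
  associator_actionHom a b c x := parAction_associator (C := C) a b c x
  leftUnitor_actionHom c x := parAction_leftUnitor (C := C) c x
  rightUnitor_actionHom c x := parAction_rightUnitor (C := C) c x

end ParAction

section CoHomAdjoint

open Opposite

variable {C : Type u₁} [Category.{v₁} C] [MonoidalCategory C] [GVCategory C]
  {M : Type u₂} [Category.{v₂} M] [MonoidalLeftAction C M] [GVModule C M]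

/-- `Hom(G⁻¹ iHom(x, n), c) ≃ Hom(G c, iHom(x, n)) ≃ Hom(G c ▷ x, n) ≃ Hom(x, c ◁̃ n)`. -/
noncomputable def parHomEquiv (n x : M) (c : C) :
    (gInvObj ((iHom C x).obj n) ⟶ c) ≃ (x ⟶ (hAct (gObj c)).obj n) where
  toFun f := hLift ((gMap f ≫ (gGInv _).hom) ⊵ₗ x ≫ iHom.ev C x n)
  invFun k := ((GVCategory.G (C := C)).functor.preimage
    (iHom.lift (hUnlift k) ≫ (gGInv _).inv)).unop
  left_inv f := gMap_injective (by
    beta_reduce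
    rw [hUnlift_hLift]
    have h : iHom.lift ((gMap f ≫ (gGInv _).hom) ⊵ₗ x ≫ iHom.ev C x n) =
        gMap f ≫ (gGInv _).hom := iHom.hom_ext (by rw [iHom.lift_ev])
    rw [h, Category.assoc, Iso.hom_inv_id, Category.comp_id]
    exact (GVCategory.G (C := C)).functor.map_preimage _)
  right_inv k := hUnlift_inj (by
    beta_reduce
    rw [hUnlift_hLift]
    have h : gMap ((GVCategory.G (C := C)).functor.preimage
        (iHom.lift (hUnlift k) ≫ (gGInv _).inv)).unop =
          iHom.lift (hUnlift k) ≫ (gGInv _).inv :=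
      (GVCategory.G (C := C)).functor.map_preimage _
    rw [h, Category.assoc, Iso.inv_hom_id, Category.comp_id, iHom.lift_ev])

theorem parHomEquiv_naturality (n x : M) {c c' : C} (h : c ⟶ c')
    (f : gInvObj ((iHom C x).obj n) ⟶ c) :
    parHomEquiv n x c' (f ≫ h) = parHomEquiv n x c f ≫ hPre (gMap h) n :=
  hUnlift_inj (by
    rw [hUnlift_comp_hPre]
    change hUnlift (hLift _) = _ ≫ hUnlift (hLift _)
    rw [hUnlift_hLift, hUnlift_hLift, gMap_comp]
    simp only [comp_actionHomLeft, Category.assoc])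

/-- The functor `c ↦ c ◁̃ n` has a left adjoint, `x ↦ G⁻¹ iHom(x, n)`. -/
instance parActionRight_isRightAdjoint (n : M) : (actionRight (Par C) n).IsRightAdjoint :=
  (Adjunction.adjunctionOfEquivLeft (G := actionRight (Par C) n)
    (F_obj := fun x => gInvObj (C := C) ((iHom C x).obj n))
    (fun x c => parHomEquiv (C := C) n x c)
    (fun x _ _ h f => parHomEquiv_naturality (C := C) n x h f)).isRightAdjoint

end CoHomAdjoint

section Admissible

universe v

variable (C : Type u₁) [Category.{v} C] [MonoidalCategory C] [GVCategory C]
  {M : Type u₂} [Category.{v} M] [MonoidalLeftAction C M] [GVModule C M]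

/-- `m` is a `C`-generator: every object is a quotient of some `c ▷ m`. -/
def IsCGenerator (m : M) : Prop := ∀ x : M, ∃ (c : C) (f : c ⊙ₗ m ⟶ x), Epi f

/-- `n` is a `C`-cogenerator: every object is a subobject of some `d ◁̃ n`. -/
def IsCCogenerator (n : M) : Prop := ∀ x : M, ∃ (d : Par C) (f : x ⟶ d ⊙ₗ n), Mono f

/-- `m` is `⊗`-admissible: the lax module functor `iHom(m, -) : M ⥤ C` is strong and has a right
adjoint. -/
def IsTensorAdmissible (m : M) : Prop :=
  (∀ (c : C) (x : M), IsIso (Functor.LaxLeftLinear.μₗ (iHom C m) c x)) ∧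
    (iHom C m).IsLeftAdjoint

/-- `n` is `par`-admissible: the oplax `(C, par)`-module functor `icoHom(n, -) : M ⥤ C` is strong
and has a left adjoint. -/
def IsParAdmissible (n : M) : Prop :=
  (∀ (c : Par C) (x : M), IsIso (Functor.OplaxLeftLinear.δₗ (icoHom (Par C) n) c x)) ∧
    (icoHom (Par C) n).IsRightAdjoint

/-- `iHom(m, -) : M ⥤ mod-iHom(m, m)`, with its canonical lax module functor structure, is an
equivalence of module categories over `(C, ⊗)`. -/
def IsIHomEquivalence (m : M) : Prop :=
  (iHomMod C m).IsEquivalence ∧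
    ∀ (c : C) (x : M), IsIso (Functor.LaxLeftLinear.μₗ (iHomMod C m) c x)

/-- `icoHom(n, -) : M ⥤ comod-icoHom(n, n)`, with its canonical oplax module functor structure, is
an equivalence of module categories over `(C, par)`. -/
def IsICoHomEquivalence (n : M) : Prop :=
  (icoHomComod (Par C) n).IsEquivalence ∧
    ∀ (c : Par C) (x : M), IsIso (Functor.OplaxLeftLinear.δₗ (icoHomComod (Par C) n) c x)

variable (M) in
/-- `M` is algebraic: it is equivalent, as a module category over `(C, ⊗)`, to `mod-A` for some
algebra `A` in `C`. -/
def IsAlgebraic : Prop :=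
  ∃ (A : C) (_ : MonObj A) (F : M ⥤ RightMod A), F.IsEquivalence ∧ Nonempty (F.LeftLinear C)

end Admissible

end GV

universe v u₁ u₂

/-!
Both halves of the theorem are instances of crude (co)monadicity.

The functor `iHom(m, -) : M ⥤ C` is right adjoint to `- ▷ m`, and its counit consists of the
evaluations `iHom(m, x) ▷ m ⟶ x`. Every morphism `c ▷ m ⟶ x` factors through the evaluation, so if
`m` is a generator, the evaluations are epimorphisms and `iHom(m, -)` is faithful
(`faithful_iHom`). A faithful functor reflects monomorphisms and epimorphisms, hence isomorphisms if
`M` is balanced. If moreover `iHom(m, -)` has a right adjoint, it preserves coequalizers, and the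
crude monadicity theorem identifies `M` with the algebras over the monad `iHom(m, - ▷ m)`.
Strongness of `iHom(m, -)` gives `iHom(m, c ▷ m) ≅ c ⊗ iHom(m, m)`, so that these algebras are the
right modules over `A_m = iHom(m, m)`, and the comparison functor is `iHom(m, -) : M ⥤ mod-A_m`
(`isEquivalence_algebraToRightMod`, `comparisonIso`, `isEquivalence_iHomMod`).

Conversely, let `F : M ⥤ mod-A` be an equivalence of module categories and let `F m` be the regular
module `A`. Then `Hom(c ▷ m, x) ≃ Hom(c ⊗ A, F x) ≃ Hom(c, F x)`, so that `iHom(m, -)` is `F`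
followed by the forgetful functor `mod-A ⥤ C` (`algebraicIso`). The forgetful functor is strictly
linear (`isIso_lineator_of_algebraic`), and every module `N` is the quotient of `N ⊗ A` by its action
(`isCGenerator_of_algebraic`). The forgetful functor has a right adjoint, the cofree module functor
`[A, -]`, because `- ⊗ A` has one (`RightMod.isLeftAdjoint_forget`): in a GV-category the tensor
product is closed on both sides (`isLeftAdjoint_tensorRight`, `isLeftAdjoint_tensorLeft`).

The statement on comodules is proved by the dual arguments for an arbitrary module category,
applied to the action of `(C, par, K)`. The existence of a left adjoint of `icoHom(n, -)` uses that
the functors `- par Z` have left adjoints: `G` turns them into the functors `G Z ⊗ -`, which have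
right adjoints (`isRightAdjoint_tensorRight_par`). The coevaluations `x ⟶ icoHom(n, x) ▷ n` are
monomorphisms because `icoHom(n, -)` sends them to coactions (`mono_coev`).
-/

namespace GV

universe v₁ v₂

/-! ### Right modules and the forgetful functor -/

namespace RightMod

section

variable {C : Type u₁} [Category.{v₁} C] [MonoidalCategory C] {A : C} [MonObj A]

variable (A) in
/-- The functor forgetting the action of `A`. -/
@[simps]
def forget : RightMod A ⥤ C where
  obj N := N.X
  map f := f.hom

instance : (forget A).Faithful where
  map_injective h := hom_ext _ _ h

instance : (forget A).ReflectsIsomorphisms where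
  reflects {_ _} f hf :=
    have : IsIso f.hom := hf
    (isoMk (asIso f.hom) f.act_hom).isIso_hom

theorem isIso_hom {N P : RightMod A} (f : N ⟶ P) [IsIso f] : IsIso f.hom :=
  (forget A).map_isIso f

theorem isIso_of_isIso_hom {N P : RightMod A} (f : N ⟶ P) (h : IsIso f.hom) : IsIso f :=
  have : IsIso ((forget A).map f) := h
  isIso_of_reflects_iso f (forget A)

variable (A) in
/-- `A` as a right module over itself. -/
def regular : RightMod A where
  X := A
  act := MonObj.mul
  act_one := MonObj.mul_one A
  act_mul := by rw [Iso.eq_inv_comp]; exact (MonObj.mul_assoc A).symm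

theorem freeDesc_act_hom {c : C} {N : RightMod A} (f : c ⟶ N.X) :
    ((α_ c A A).hom ≫ c ◁ MonObj.mul) ≫ f ▷ A ≫ N.act = (f ▷ A ≫ N.act) ▷ A ≫ N.act := by
  simp only [Category.assoc, comp_whiskerRight]
  rw [whisker_exchange_assoc, N.act_mul]
  simp

/-- The module morphism `c ⊗ A ⟶ N` extending `f : c ⟶ N` along the unit of `A`. -/
def freeDesc {c : C} {N : RightMod A} (f : c ⟶ N.X) : c ⊙ₗ regular A ⟶ N :=
  ⟨f ▷ A ≫ N.act, freeDesc_act_hom f⟩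

theorem freeDesc_comp {c : C} {N P : RightMod A} (f : c ⟶ N.X) (g : N ⟶ P) :
    freeDesc f ≫ g = freeDesc (f ≫ g.hom) := RightMod.hom_ext _ _ (by
  change (f ▷ A ≫ N.act) ≫ g.hom = (f ≫ g.hom) ▷ A ≫ P.act
  rw [Category.assoc, g.act_hom, comp_whiskerRight_assoc])

theorem actionHomLeft_freeDesc {c d : C} {N : RightMod A} (f : c ⟶ d) (g : d ⟶ N.X) :
    f ⊵ₗ regular A ≫ freeDesc g = freeDesc (f ≫ g) := RightMod.hom_ext _ _ (by
  change f ▷ A ≫ g ▷ A ≫ N.act = (f ≫ g) ▷ A ≫ N.act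
  rw [comp_whiskerRight_assoc])

/-- A module morphism out of `c ⊗ N`, precomposed with the action on `N`, is the extension of its
underlying morphism to `(c ⊗ N) ⊗ A`. -/
theorem actionHomRight_freeDesc_id {c : C} {N P : RightMod A} (g : c ⊙ₗ N ⟶ P)
    {l : c ⊗ N.X ⟶ P.X} (hl : g.hom = l) :
    (αₗ c N.X (regular A)).hom ≫ c ⊴ₗ freeDesc (𝟙 N.X) ≫ g = freeDesc l :=
  RightMod.hom_ext _ _ (by
    have h : ((α_ c N.X A).hom ≫ c ◁ N.act) ≫ l = l ▷ A ≫ P.act := hl ▸ g.act_hom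
    change (α_ c N.X A).hom ≫ c ◁ (𝟙 N.X ▷ A ≫ N.act) ≫ g.hom = l ▷ A ≫ P.act
    rw [hl, ← h]
    simp)

theorem freeDesc_unit {c : C} (N : RightMod A) (f : c ⟶ N.X) :
    (ρ_ c).inv ≫ c ◁ MonObj.one ≫ f ▷ A ≫ N.act = f := by
  rw [whisker_exchange_assoc, N.act_one]
  simp

theorem unit_freeDesc {c : C} (N : RightMod A) (g : c ⊗ A ⟶ N.X)
    (hg : ((α_ c A A).hom ≫ c ◁ MonObj.mul) ≫ g = g ▷ A ≫ N.act) :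
    ((ρ_ c).inv ≫ c ◁ MonObj.one ≫ g) ▷ A ≫ N.act = g := by
  have h : c ◁ (MonObj.one (X := A)) ▷ A ≫ c ◁ MonObj.mul = c ◁ (λ_ A).hom := by
    rw [← MonoidalCategory.whiskerLeft_comp, MonObj.one_mul]
  simp only [comp_whiskerRight, Category.assoc]
  rw [← hg]
  simp [reassoc_of% h]

/-- Module morphisms out of the free module `c ⊗ A` are morphisms out of `c`. -/
def freeHomEquiv (c : C) (N : RightMod A) : (c ⊙ₗ regular A ⟶ N) ≃ (c ⟶ N.X) where
  toFun g := (ρ_ c).inv ≫ c ◁ MonObj.one (X := A) ≫ g.hom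
  invFun f := freeDesc f
  left_inv g := hom_ext _ _ (unit_freeDesc N g.hom g.act_hom)
  right_inv f := freeDesc_unit N f

/-- Every module is a quotient of a free one: the action `N ⊗ A ⟶ N` is split by the unit
of `A` on underlying objects. -/
instance epi_freeDesc_id (N : RightMod A) : Epi (freeDesc (𝟙 N.X)) := by
  have : IsSplitEpi ((forget A).map (freeDesc (𝟙 N.X))) :=
    ⟨⟨⟨(ρ_ N.X).inv ≫ N.X ◁ MonObj.one (X := A),
      (Category.assoc _ _ _).trans (freeDesc_unit N (𝟙 N.X))⟩⟩⟩
  exact (forget A).epi_of_epi_map inferInstance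

end

section Cofree

variable {C : Type u₁} [Category.{v₁} C] [MonoidalCategory C] {A : C}

section

variable {R : C ⥤ C} (adj : tensorRight A ⊣ R)

/-- The adjunction bijection `Hom(x ⊗ A, y) → Hom(x, [A, y])`. -/
def curryRight {x y : C} (f : x ⊗ A ⟶ y) : x ⟶ R.obj y := adj.homEquiv x y f

/-- The evaluation `[A, y] ⊗ A ⟶ y`. -/
def evRight (y : C) : R.obj y ⊗ A ⟶ y := adj.counit.app y

theorem curryRight_ev {x y : C} (f : x ⊗ A ⟶ y) : curryRight adj f ▷ A ≫ evRight adj y = f :=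
  ((adj.homEquiv_counit _ _ _).symm.trans ((adj.homEquiv x y).symm_apply_apply f))

theorem hom_ext_of_evRight {x y : C} {f g : x ⟶ R.obj y}
    (h : f ▷ A ≫ evRight adj y = g ▷ A ≫ evRight adj y) : f = g :=
  (adj.homEquiv x y).symm.injective
    ((adj.homEquiv_counit _ _ _).trans (h.trans (adj.homEquiv_counit _ _ _).symm))

end

variable [MonObj A] {R : C ⥤ C} (adj : tensorRight A ⊣ R)

/-- The cofree module `[A, y]`, for `[A, -]` right adjoint to `- ⊗ A`. Its action is determined by
`([A, y] ⊗ A) ⊗ A ⟶ [A, y] ⊗ A ⟶ y`, multiplication in `A` followed by evaluation. -/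
def cofree (y : C) : RightMod A where
  X := R.obj y
  act := curryRight adj ((α_ _ _ _).hom ≫ R.obj y ◁ MonObj.mul ≫ evRight adj y)
  act_one := hom_ext_of_evRight adj (by
    rw [comp_whiskerRight, Category.assoc, curryRight_ev, associator_naturality_middle_assoc,
      ← MonoidalCategory.whiskerLeft_comp_assoc, MonObj.one_mul]
    simp)
  act_mul := hom_ext_of_evRight adj (by
    simp only [comp_whiskerRight, Category.assoc, curryRight_ev]
    rw [associator_naturality_left_assoc, ← whisker_exchange_assoc, curryRight_ev,
      associator_naturality_middle_assoc, ← MonoidalCategory.whiskerLeft_comp_assoc,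
      MonObj.mul_assoc]
    simp)

theorem cofreeDesc_act_hom (N : RightMod A) {y : C} (f : N.X ⟶ y) :
    N.act ≫ curryRight adj (N.act ≫ f) =
      curryRight adj (N.act ≫ f) ▷ A ≫ (cofree adj y).act :=
  hom_ext_of_evRight adj (by
    change _ = (_ ≫ curryRight adj _) ▷ A ≫ _
    simp only [comp_whiskerRight, Category.assoc, curryRight_ev]
    rw [associator_naturality_left_assoc, ← whisker_exchange_assoc, curryRight_ev,
      reassoc_of% N.act_mul]
    simp)

theorem unit_curryRight_ev (N : RightMod A) {y : C} (g : N.X ⟶ R.obj y)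
    (hg : N.act ≫ g = g ▷ A ≫
      curryRight adj ((α_ _ _ _).hom ≫ R.obj y ◁ MonObj.mul ≫ evRight adj y)) :
    N.act ≫ (ρ_ N.X).inv ≫ N.X ◁ MonObj.one (X := A) ≫ g ▷ A ≫ evRight adj y =
      g ▷ A ≫ evRight adj y := by
  have h : N.act ▷ A ≫ g ▷ A ≫ evRight adj y =
      g ▷ A ▷ A ≫ (α_ _ _ _).hom ≫ R.obj y ◁ MonObj.mul ≫ evRight adj y := by
    rw [← comp_whiskerRight_assoc, hg, comp_whiskerRight_assoc, curryRight_ev]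
  have h' : R.obj y ◁ A ◁ MonObj.one (X := A) ≫ R.obj y ◁ MonObj.mul =
      R.obj y ◁ (ρ_ A).hom := by
    rw [← MonoidalCategory.whiskerLeft_comp, MonObj.mul_one]
  rw [rightUnitor_inv_naturality_assoc, ← whisker_exchange_assoc, h,
    whisker_exchange_assoc]
  simp [reassoc_of% h']

/-- Morphisms into the cofree module `[A, y]` are morphisms into `y`. -/
def cofreeHomEquiv (N : RightMod A) (y : C) : (N.X ⟶ y) ≃ (N ⟶ cofree adj y) where
  toFun f := ⟨curryRight adj (N.act ≫ f), cofreeDesc_act_hom adj N f⟩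
  invFun g := (ρ_ N.X).inv ≫ N.X ◁ MonObj.one (X := A) ≫ g.hom ▷ A ≫ evRight adj y
  left_inv f := by
    change _ ≫ _ ≫ curryRight adj _ ▷ A ≫ _ = _
    rw [curryRight_ev, reassoc_of% N.act_one]
    simp
  right_inv g := hom_ext _ _ (hom_ext_of_evRight adj ((curryRight_ev adj _).trans
    (unit_curryRight_ev adj N g.hom g.act_hom)))

/-- The forgetful functor is left adjoint to the cofree module functor. -/
theorem isLeftAdjoint_forget [(tensorRight A).IsLeftAdjoint] : (forget A).IsLeftAdjoint :=
  (Adjunction.adjunctionOfEquivRight (F := forget A)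
    (G_obj := cofree (Adjunction.ofIsLeftAdjoint (tensorRight A)))
    (fun N y => cofreeHomEquiv (Adjunction.ofIsLeftAdjoint (tensorRight A)) N y)
    (fun N' N y f g => hom_ext _ _ (hom_ext_of_evRight _ (by
      change curryRight _ _ ▷ A ≫ _ = (_ ≫ curryRight _ _) ▷ A ≫ _
      rw [comp_whiskerRight_assoc, curryRight_ev, curryRight_ev]
      exact Hom.act_hom_assoc f g)))).isLeftAdjoint

end Cofree

end RightMod

/-! ### Closedness of the two tensor products of a GV-category -/

section Closed

variable {C : Type u₁} [Category.{v₁} C] [MonoidalCategory C] [GVCategory C]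

/-- `- ⊗ y` has the right adjoint `z ↦ G (y ⊗ G⁻¹ z)`:
`Hom(x ⊗ y, z) ≃ Hom((x ⊗ y) ⊗ G⁻¹ z, K) ≃ Hom(x ⊗ (y ⊗ G⁻¹ z), K) ≃ Hom(x, G (y ⊗ G⁻¹ z))`. -/
instance isLeftAdjoint_tensorRight (y : C) : (tensorRight y).IsLeftAdjoint :=
  (Adjunction.adjunctionOfEquivRight (F := tensorRight y)
    (G_obj := fun z => gObj (y ⊗ gInvObj z))
    (fun x z => (((Iso.refl (x ⊗ y)).homCongr (gGInv z).symm).trans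
      (GVCategory.homEquiv (x ⊗ y) (gInvObj z)).symm).trans
        (((α_ x y (gInvObj z)).homCongr (Iso.refl _)).trans (GVCategory.homEquiv _ _)))
    (fun x' x z f g => by
      have h : (GVCategory.homEquiv (x' ⊗ y) (gInvObj z)).symm
          (f ▷ y ≫ g ≫ GVCategory.G.counitIso.inv.app z) =
          f ▷ y ▷ _ ≫ (GVCategory.homEquiv (x ⊗ y) (gInvObj z)).symm
            (g ≫ GVCategory.G.counitIso.inv.app z) := by
        rw [Equiv.symm_apply_eq, GVCategory.homEquiv_naturality_left, Equiv.apply_symm_apply]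
      have h' := GVCategory.homEquiv_naturality_left f ((α_ x y (gInvObj z)).inv ≫
        (GVCategory.homEquiv (x ⊗ y) (gInvObj z)).symm (g ≫ (gGInv z).inv))
      simpa [h] using h')).isLeftAdjoint

/-- The action of `G` on morphisms, as a bijection. -/
noncomputable def gMapEquiv (x y : C) : (x ⟶ y) ≃ (gObj y ⟶ gObj x) :=
  Equiv.ofBijective gMap ⟨fun _ _ h => gMap_injective h, fun f =>
    ⟨((GVCategory.G (C := C)).functor.preimage f).unop,
      (GVCategory.G (C := C)).functor.map_preimage f⟩⟩

theorem gMap_gMapEquiv_symm {x y : C} (f : gObj y ⟶ gObj x) : gMap ((gMapEquiv x y).symm f) = f :=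
  (gMapEquiv x y).apply_symm_apply f

/-- `x ⊗ -` has the right adjoint `z ↦ G⁻¹ (G z ⊗ x)`: `Hom(x ⊗ y, z) ≃ Hom(G z, G (x ⊗ y))`
`≃ Hom(G z ⊗ (x ⊗ y), K) ≃ Hom((G z ⊗ x) ⊗ y, K) ≃ Hom(G z ⊗ x, G y) ≃ Hom(y, G⁻¹ (G z ⊗ x))`. -/
instance isLeftAdjoint_tensorLeft (x : C) : (tensorLeft x).IsLeftAdjoint :=
  (Adjunction.adjunctionOfEquivRight (F := tensorLeft x)
    (G_obj := fun z => gInvObj (gObj z ⊗ x))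
    (fun y z => ((gMapEquiv (x ⊗ y) z).trans
      ((GVCategory.homEquiv (gObj z) (x ⊗ y)).symm.trans
        ((α_ (gObj z) x y).symm.homCongr (Iso.refl _)))).trans
          ((GVCategory.homEquiv _ _).trans
            (((gGInv (gObj z ⊗ x)).symm.homCongr (Iso.refl _)).trans (gMapEquiv _ _).symm)))
    (fun y' y z f g => by
      have h : (GVCategory.homEquiv (gObj z) (x ⊗ y')).symm (gMap (x ◁ f ≫ g)) =
          gObj z ◁ x ◁ f ≫ (GVCategory.homEquiv (gObj z) (x ⊗ y)).symm (gMap g) := by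
        rw [Equiv.symm_apply_eq, GVCategory.homEquiv_naturality_right, Equiv.apply_symm_apply,
          gMap_comp]
      have h' := GVCategory.homEquiv_naturality_right (gObj z ⊗ x) f ((α_ (gObj z) x y).hom ≫
        (GVCategory.homEquiv (gObj z) (x ⊗ y)).symm (gMap g))
      apply gMap_injective
      have h₀ : gMapEquiv (x ⊗ y') z (x ◁ f ≫ g) = gMap (x ◁ f ≫ g) := rfl
      have h₁ : gMapEquiv (x ⊗ y) z g = gMap g := rfl
      simp only [tensor_whiskerLeft, Category.assoc, Iso.inv_hom_id_assoc] at h'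
      simp only [curriedTensor_obj_map, Equiv.trans_apply, gMap_comp, gMap_gMapEquiv_symm, h₀, h₁,
        Iso.homCongr_apply, Iso.refl_hom, Category.comp_id, Iso.symm_inv, Category.assoc,
        ← h']
      rw [← gMap_comp, h])).isLeftAdjoint

theorem gInvMap_whiskerLeft (z : C) {x y : C} (f : x ⟶ y) :
    gInvMap (gObj z ◁ gMap f) = parMap f (𝟙 z) := by
  rw [parMap, gMap_id, id_tensorHom]

variable (C) in
/-- The functor `- par z`, as the composite of `G : C ⥤ Cᵒᵖ`, the opposite of `G z ⊗ -`, and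
`G⁻¹ : Cᵒᵖ ⥤ C`. -/
def parRight (z : C) : C ⥤ C :=
  (GVCategory.G (C := C)).functor.rightOp ⋙ (tensorLeft (gObj z)).op ⋙
    (GVCategory.G (C := C)).inverse.leftOp

instance isRightAdjoint_parRight (z : C) : (parRight C z).IsRightAdjoint := by
  unfold parRight
  infer_instance

/-- In `(C, par, K)`, the functor `- par Z = G⁻¹ (G Z ⊗ G -)` has a left adjoint, since `G Z ⊗ -`
has a right adjoint. -/
instance isRightAdjoint_tensorRight_par (Z : Par C) : (tensorRight Z).IsRightAdjoint :=
  let F : Par C ⥤ Par C := parRight C Z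
  have : F.IsRightAdjoint := isRightAdjoint_parRight (C := C) Z
  have e : F ≅ tensorRight Z := NatIso.ofComponents
    (fun y => Iso.refl (F.obj y)) (fun f =>
      (Category.comp_id _).trans
        ((gInvMap_whiskerLeft (C := C) Z f).trans (Category.id_comp _).symm))
  Functor.isRightAdjoint_of_iso e

end Closed

/-! ### Algebraic module categories -/

section InternalHomUnique

variable {C : Type u₁} [Category.{v₁} C] [MonoidalCategory C]
  {M : Type u₂} [Category.{v₂} M] [MonoidalLeftAction C M]

/-- The lineator of `iHom(m, -)` can be computed on representing objects `a ≅ iHom(m, x)` and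
`b ≅ iHom(m, c ▷ x)`. -/
theorem isIso_lineator_of_iso {m : M} [(actionRight C m).IsLeftAdjoint] {c : C} {x : M} {a b : C}
    (f : a ≅ (iHom C m).obj x) (g : b ≅ (iHom C m).obj (c ⊙ₗ x)) (l : c ⊗ a ⟶ b) (hl : IsIso l)
    (h : l ⊵ₗ m ≫ g.hom ⊵ₗ m ≫ iHom.ev C m (c ⊙ₗ x) =
      (αₗ c a m).hom ≫ c ⊴ₗ (f.hom ⊵ₗ m ≫ iHom.ev C m x)) :
    IsIso (iHom.lineator C m c x) := by
  have key : c ◁ f.hom ≫ iHom.lineator C m c x = l ≫ g.hom := by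
    apply iHom.hom_ext
    rw [comp_actionHomLeft, comp_actionHomLeft, Category.assoc, Category.assoc, h,
      iHom.lineator_ev, whiskerLeft_actionHomLeft]
    simp only [Category.assoc, Iso.inv_hom_id_assoc, actionHomRight_comp]
  have : IsIso (c ◁ f.hom ≫ iHom.lineator C m c x) := by
    rw [key]
    infer_instance
  exact IsIso.of_isIso_comp_left (c ◁ f.hom) _

end InternalHomUnique

section Algebraic

variable {C : Type u₁} [Category.{v₁} C] [MonoidalCategory C]
  {M : Type u₂} [Category.{v₂} M] [MonoidalLeftAction C M]
  {A : C} [MonObj A] (F : M ⥤ RightMod A) [F.IsEquivalence] [F.LeftLinear C]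
  {m : M} (e : RightMod.regular A ≅ F.obj m)

open Functor.LaxLeftLinear Functor.OplaxLeftLinear RightMod

/-- If `F m` is the regular module, then `Hom(c ▷ m, x) ≃ Hom(c ⊗ A, F x) ≃ Hom(c, F x)`. -/
noncomputable def algebraicHomEquiv (c : C) (x : M) : (c ⊙ₗ m ⟶ x) ≃ (c ⟶ (F.obj x).X) :=
  (Functor.FullyFaithful.ofFullyFaithful F).homEquiv.trans
    (((Functor.LeftLinear.μₗIso F c m).symm.homCongr (Iso.refl _)).trans
      ((((actionLeft (RightMod A) c).mapIso e).symm.homCongr (Iso.refl (F.obj x))).trans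
        (freeHomEquiv c (F.obj x))))

theorem map_algebraicHomEquiv_symm (c : C) (x : M) (f : c ⟶ (F.obj x).X) :
    F.map ((algebraicHomEquiv F e c x).symm f) = δₗ F c m ≫ c ⊴ₗ e.inv ≫ freeDesc f := by
  refine (Functor.FullyFaithful.ofFullyFaithful F).map_preimage _ |>.trans ?_
  change ((δₗ F c m ≫ (c ⊴ₗ e.inv ≫ freeDesc f ≫ 𝟙 _) ≫ 𝟙 _)) = _
  simp

theorem algebraicHomEquiv_naturality_left {c c' : C} (f : c' ⟶ c) {x : M}
    (g : c ⟶ (F.obj x).X) : (algebraicHomEquiv F e c' x).symm (f ≫ g) =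
      f ⊵ₗ m ≫ (algebraicHomEquiv F e c x).symm g := by
  apply F.map_injective
  rw [F.map_comp, map_algebraicHomEquiv_symm, map_algebraicHomEquiv_symm,
    δₗ_naturality_left_assoc, ← action_exchange_assoc]
  congr 2
  exact (actionHomLeft_freeDesc f g).symm

theorem algebraicHomEquiv_naturality_right {c : C} {x y : M} (g : c ⟶ (F.obj x).X) (f : x ⟶ y) :
    (algebraicHomEquiv F e c y).symm (g ≫ (F.map f).hom) =
      (algebraicHomEquiv F e c x).symm g ≫ f := by
  apply F.map_injective
  rw [F.map_comp, map_algebraicHomEquiv_symm, map_algebraicHomEquiv_symm,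
    Category.assoc, Category.assoc]
  congr 2
  exact (freeDesc_comp g (F.map f)).symm

/-- If `F m` is the regular module, then the underlying object of `F x` is an internal Hom
`iHom(m, x)`. -/
noncomputable def algebraicAdjunction : actionRight C m ⊣ F ⋙ forget A :=
  Adjunction.mkOfHomEquiv
    { homEquiv := algebraicHomEquiv F e
      homEquiv_naturality_left_symm := fun f g => algebraicHomEquiv_naturality_left F e f g
      homEquiv_naturality_right := fun {c x y} g f => by
        have h := algebraicHomEquiv_naturality_right F e (algebraicHomEquiv F e c x g) f
        exact ((Equiv.symm_apply_eq _).mp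
          (h.trans (congrArg (· ≫ f) (Equiv.symm_apply_apply _ g)))).symm }

/-- If `F m` is the regular module, then `F x ≅ iHom(m, x)`. -/
noncomputable def algebraicIso [(actionRight C m).IsLeftAdjoint] :
    F ⋙ forget A ≅ iHom C m :=
  (algebraicAdjunction F e).rightAdjointUniq (iHom.adj C m)

/-- The component of `algebraicIso` at `x`, with its source spelled `(F.obj x).X`. -/
noncomputable def algebraicIsoApp [(actionRight C m).IsLeftAdjoint] (x : M) :
    (F.obj x).X ≅ (iHom C m).obj x :=
  (algebraicIso F e).app x

/-- Under `F x ≅ iHom(m, x)`, the evaluation corresponds to the action `F x ⊗ A ⟶ F x`. -/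
theorem map_algebraicIsoApp_ev [(actionRight C m).IsLeftAdjoint] (x : M) :
    F.map ((algebraicIsoApp F e x).hom ⊵ₗ m ≫ iHom.ev C m x) =
      δₗ F (F.obj x).X m ≫ (F.obj x).X ⊴ₗ e.inv ≫ freeDesc (𝟙 (F.obj x).X) := by
  rw [← map_algebraicHomEquiv_symm]
  congr 1
  refine (Adjunction.rightAdjointUniq_hom_app_counit
    (algebraicAdjunction F e) (iHom.adj C m) x).trans ?_
  simp only [algebraicAdjunction, Adjunction.mkOfHomEquiv_counit_app]
  rfl

/-- If `F m` is the regular module, then the isomorphism `F x ≅ iHom(m, x)` identifies the lineator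
of `iHom(m, -)` with the morphism underlying that of `F`, since the forgetful functor from modules
is strictly linear. -/
theorem isIso_lineator_of_algebraic (F : M ⥤ RightMod A) [F.IsEquivalence]
    [F.LeftLinear C] {m : M} (e : regular A ≅ F.obj m) [(actionRight C m).IsLeftAdjoint]
    (c : C) (x : M) : IsIso (iHom.lineator C m c x) := by
  let l : c ⊗ (F.obj x).X ⟶ (F.obj (c ⊙ₗ x)).X := (μₗ F c x).hom
  have hl : IsIso l := RightMod.isIso_hom (μₗ F c x)
  refine isIso_lineator_of_iso (algebraicIsoApp F e x) (algebraicIsoApp F e (c ⊙ₗ x)) l hl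
    (F.map_injective ?_)
  have h₁ {y : M} (k : y ⟶ x) : F.map (c ⊴ₗ k) = δₗ F c _ ≫ c ⊴ₗ F.map k ≫ μₗ F c x := by
    simp
  have h₂ := δₗ_associativity F c (F.obj x).X m
  rw [F.map_comp (l ⊵ₗ m), F.map_comp (αₗ _ _ _).hom, h₁,
    map_algebraicIsoApp_ev, map_algebraicIsoApp_ev, δₗ_naturality_left_assoc,
    ← action_exchange_assoc, actionHomLeft_freeDesc, Category.comp_id,
    ← actionHomRight_freeDesc_id (μₗ F c x) rfl]
  simp only [actionHomRight_comp, Category.assoc, tensor_actionHomRight, Iso.inv_hom_id_assoc]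
  rw [reassoc_of% h₂]

/-- The action `F x ⊗ A ⟶ F x`, transported along `F`, is an epimorphism from `F x ▷ m` to `x`. -/
theorem isCGenerator_of_algebraic (F : M ⥤ RightMod A) [F.IsEquivalence]
    [F.LeftLinear C] {m : M} (e : regular A ≅ F.obj m) (x : M) :
    ∃ (c : C) (f : c ⊙ₗ m ⟶ x), Epi f :=
  ⟨(F.obj x).X, (algebraicHomEquiv F e _ x).symm (𝟙 _), F.epi_of_epi_map (by
    rw [map_algebraicHomEquiv_symm]
    infer_instance)⟩

theorem isLeftAdjoint_iHom_of_algebraic (F : M ⥤ RightMod A) [F.IsEquivalence]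
    [F.LeftLinear C] {m : M} (e : regular A ≅ F.obj m) [(actionRight C m).IsLeftAdjoint]
    [(tensorRight A).IsLeftAdjoint] : (iHom C m).IsLeftAdjoint :=
  have := isLeftAdjoint_forget (A := A)
  Functor.isLeftAdjoint_of_iso (algebraicIso F e)

end Algebraic

/-! ### Monadicity of the internal Hom -/

section Comparison

variable {C : Type u₁} [Category.{v₁} C] [MonoidalCategory C]
  {M : Type u₂} [Category.{v₂} M] [MonoidalLeftAction C M]
  (m : M) [(actionRight C m).IsLeftAdjoint]

namespace iHom

/-- The coevaluation `c ⟶ iHom(m, c ▷ m)`. -/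
noncomputable def coev (c : C) : c ⟶ (iHom C m).obj (c ⊙ₗ m) := (adj C m).unit.app c

theorem coev_ev (c : C) : coev m c ⊵ₗ m ≫ ev C m (c ⊙ₗ m) = 𝟙 _ :=
  (adj C m).left_triangle_components c

/-- The lineators intertwine the unit of the monad `iHom(m, - ▷ m)` with the unit of the algebra
`iHom(m, m)`. -/
theorem unit_lineator (c : C) :
    c ◁ unit C m ≫ lineator C m c m = (ρ_ c).hom ≫ coev m c :=
  hom_ext (by
    simp [coev_ev, ← actionHomRight_comp, unit_ev])

theorem lineator_map_ev (x : M) :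
    lineator C m ((iHom C m).obj x) m ≫ (iHom C m).map (ev C m x) = comp C m m x :=
  hom_ext (by simp)

theorem lineator_map_actionHomLeft {c d : C} (f : c ⟶ d) (x : M) :
    lineator C m c x ≫ (iHom C m).map (f ⊵ₗ x) = f ▷ (iHom C m).obj x ≫ lineator C m d x :=
  (Functor.LaxLeftLinear.μₗ_naturality_left (iHom C m) f x).symm

/-- The lineators intertwine the multiplication of the monad `iHom(m, - ▷ m)` with the
multiplication of the algebra `iHom(m, m)`. -/
theorem whiskerRight_lineator_map_ev (c : C) :
    lineator C m c m ▷ (iHom C m).obj m ≫ lineator C m ((iHom C m).obj (c ⊙ₗ m)) m ≫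
      (iHom C m).map (ev C m (c ⊙ₗ m)) =
        (α_ c _ _).hom ≫ c ◁ comp C m m m ≫ lineator C m c m := by
  rw [lineator_map_ev, ← lineator_comp, Category.assoc]

variable {m}

theorem algebra_act_one {X : C} (a : (iHom C m).obj (X ⊙ₗ m) ⟶ X) (h : coev m X ≫ a = 𝟙 X) :
    X ◁ unit C m ≫ lineator C m X m ≫ a = (ρ_ X).hom := by
  rw [← Category.assoc, unit_lineator, Category.assoc, h, Category.comp_id]

theorem algebra_act_mul {X : C} (a : (iHom C m).obj (X ⊙ₗ m) ⟶ X)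
    (h : (iHom C m).map (ev C m (X ⊙ₗ m)) ≫ a = (iHom C m).map (a ⊵ₗ m) ≫ a) :
    X ◁ comp C m m m ≫ lineator C m X m ≫ a = (α_ X _ _).inv ≫
      (lineator C m X m ≫ a) ▷ (iHom C m).obj m ≫ lineator C m X m ≫ a := by
  have h' := whiskerRight_lineator_map_ev m X
  rw [Iso.eq_inv_comp, ← reassoc_of% h', h, reassoc_of% (lineator_map_actionHomLeft m a m),
    comp_whiskerRight_assoc]

theorem algebra_hom {X Y : C} (a : (iHom C m).obj (X ⊙ₗ m) ⟶ X)
    (b : (iHom C m).obj (Y ⊙ₗ m) ⟶ Y) (f : X ⟶ Y) (h : (iHom C m).map (f ⊵ₗ m) ≫ b = a ≫ f) :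
    (lineator C m X m ≫ a) ≫ f = f ▷ (iHom C m).obj m ≫ lineator C m Y m ≫ b := by
  rw [Category.assoc, ← h, reassoc_of% (lineator_map_actionHomLeft m f m)]

theorem algebra_hom_of_module_hom {X Y : C} [IsIso (lineator C m X m)]
    (a : (iHom C m).obj (X ⊙ₗ m) ⟶ X) (b : (iHom C m).obj (Y ⊙ₗ m) ⟶ Y) (f : X ⟶ Y)
    (h : (lineator C m X m ≫ a) ≫ f = f ▷ (iHom C m).obj m ≫ lineator C m Y m ≫ b) :
    (iHom C m).map (f ⊵ₗ m) ≫ b = a ≫ f := by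
  rw [← cancel_epi (lineator C m X m), reassoc_of% (lineator_map_actionHomLeft m f m), ← h,
    Category.assoc]

theorem lineator_inv_act {X : C} [IsIso (lineator C m X m)] (a : X ⊗ (iHom C m).obj m ⟶ X) :
    (lineator C m X m ≫ inv (lineator C m X m) ≫ a) ≫ 𝟙 X =
      𝟙 X ▷ (iHom C m).obj m ≫ a := by
  simp

theorem algebra_unit_of_module {X : C} [IsIso (lineator C m X m)]
    (a : X ⊗ (iHom C m).obj m ⟶ X) (h : X ◁ unit C m ≫ a = (ρ_ X).hom) :
    coev m X ≫ inv (lineator C m X m) ≫ a = 𝟙 X := by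
  rw [← cancel_epi (ρ_ X).hom, ← reassoc_of% (unit_lineator m X), IsIso.hom_inv_id_assoc, h,
    Category.comp_id]

theorem algebra_assoc_of_module {X : C} [∀ c : C, IsIso (lineator C m c m)]
    (a : X ⊗ (iHom C m).obj m ⟶ X)
    (h : X ◁ comp C m m m ≫ a = (α_ X _ _).inv ≫ a ▷ (iHom C m).obj m ≫ a) :
    (iHom C m).map (ev C m (X ⊙ₗ m)) ≫ inv (lineator C m X m) ≫ a =
      (iHom C m).map ((inv (lineator C m X m) ≫ a) ⊵ₗ m) ≫ inv (lineator C m X m) ≫ a := by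
  rw [← cancel_epi (lineator C m ((iHom C m).obj (X ⊙ₗ m)) m),
    ← cancel_epi (lineator C m X m ▷ (iHom C m).obj m),
    reassoc_of% (whiskerRight_lineator_map_ev m X),
    reassoc_of% (lineator_map_actionHomLeft m (inv (lineator C m X m) ≫ a) m)]
  rw [IsIso.hom_inv_id_assoc, h, ← comp_whiskerRight_assoc,
    IsIso.hom_inv_id_assoc, Iso.hom_inv_id_assoc]

end iHom

/-- An algebra over the monad `iHom(m, - ▷ m)` is a right module over `iHom(m, m)`, by restriction
along the lineator `X ⊗ iHom(m, m) ⟶ iHom(m, X ▷ m)`. -/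
noncomputable def algebraToRightMod : (iHom.adj C m).toMonad.Algebra ⥤ RightMod (iEnd C m) where
  obj S :=
    { X := S.A
      act := iHom.lineator C m S.A m ≫ S.a
      act_one := iHom.algebra_act_one S.a S.unit
      act_mul := iHom.algebra_act_mul S.a S.assoc }
  map {S T} f := ⟨f.f, iHom.algebra_hom S.a T.a f.f f.h⟩

theorem iHomMod_act_eq (x : M) :
    (iHom.lineator C m ((iHom C m).obj x) m ≫ (iHom C m).map (iHom.ev C m x)) ≫ 𝟙 _ =
      𝟙 ((iHom C m).obj x) ▷ (iHom C m).obj m ≫ iHom.comp C m m x := by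
  simp [iHom.lineator_map_ev]

/-- The functor `iHom(m, -) : M ⥤ mod-A_m` is the monadic comparison functor. -/
noncomputable def comparisonIso :
    Monad.comparison (iHom.adj C m) ⋙ algebraToRightMod m ≅ iHomMod C m :=
  NatIso.ofComponents (fun x => RightMod.isoMk (Iso.refl ((iHom C m).obj x)) (iHomMod_act_eq m x))
    (fun f => RightMod.hom_ext _ _
      ((Category.comp_id ((iHom C m).map f)).trans (Category.id_comp _).symm))

variable [∀ c : C, IsIso (iHom.lineator C m c m)]

/-- If the lineators `c ⊗ iHom(m, m) ⟶ iHom(m, c ▷ m)` are invertible, then the monad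
`iHom(m, - ▷ m)` is `- ⊗ iHom(m, m)`, so the two notions of modules agree. -/
instance isEquivalence_algebraToRightMod : (algebraToRightMod (C := C) m).IsEquivalence where
  faithful := ⟨fun h => Monad.Algebra.Hom.ext (congrArg RightMod.Hom.hom h)⟩
  full := ⟨fun {S T} f => ⟨⟨f.hom, iHom.algebra_hom_of_module_hom S.a T.a f.hom f.act_hom⟩, rfl⟩⟩
  essSurj := ⟨fun N => ⟨
    { A := N.X
      a := show (iHom C m).obj (N.X ⊙ₗ m) ⟶ N.X from inv (iHom.lineator C m N.X m) ≫ N.act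
      unit := iHom.algebra_unit_of_module (X := N.X) N.act N.act_one
      assoc := iHom.algebra_assoc_of_module (X := N.X) N.act N.act_mul },
    ⟨RightMod.isoMk (Iso.refl N.X) (iHom.lineator_inv_act (X := N.X) N.act)⟩⟩⟩

end Comparison

section Monadic

variable {C : Type u₁} [Category.{v} C] [MonoidalCategory C]
  {M : Type u₂} [Category.{v} M] [MonoidalLeftAction C M]
  (m : M) [(actionRight C m).IsLeftAdjoint]

/-- If `m` is a generator, then the evaluations `iHom(m, x) ▷ m ⟶ x` are epimorphisms,
so that `iHom(m, -)` is faithful. -/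
theorem faithful_iHom (h : ∀ x : M, ∃ (c : C) (f : c ⊙ₗ m ⟶ x), Epi f) :
    (iHom C m).Faithful := by
  have h' (x : M) : Epi (iHom.ev C m x) := by
    obtain ⟨c, f, hf⟩ := h x
    rw [← iHom.lift_ev f] at hf
    exact epi_of_epi (iHom.lift f ⊵ₗ m) _
  have (x : M) : Epi ((iHom.adj C m).counit.app x) := h' x
  exact (iHom.adj C m).faithful_R_of_epi_counit_app

/-- In a balanced category, the faithful functor `iHom(m, -)` reflects isomorphisms, so the crude
monadicity theorem applies. -/
theorem isEquivalence_iHomMod [Balanced M] [Limits.HasCoequalizers M]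
    [∀ c : C, IsIso (iHom.lineator C m c m)] [(iHom C m).IsLeftAdjoint]
    (h : ∀ x : M, ∃ (c : C) (f : c ⊙ₗ m ⟶ x), Epi f) : (iHomMod C m).IsEquivalence := by
  have := faithful_iHom m h
  have : (iHom C m).ReflectsIsomorphisms := inferInstance
  have : Limits.PreservesColimits (iHom C m) :=
    (Adjunction.ofIsLeftAdjoint (iHom C m)).leftAdjoint_preservesColimits
  have : Monad.PreservesColimitOfIsReflexivePair (iHom C m) := ⟨fun _ _ _ _ _ => inferInstance⟩
  have : (Monad.comparison (iHom.adj C m)).IsEquivalence :=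
    (Monad.monadicOfHasPreservesReflexiveCoequalizersOfReflectsIsomorphisms (iHom.adj C m)).eqv
  exact Functor.isEquivalence_of_iso (comparisonIso m)

end Monadic

section

variable {C : Type u₁} [Category.{v} C] [MonoidalCategory C] [GVCategory C]
  {M : Type u₂} [Category.{v} M] [MonoidalLeftAction C M] [GVModule C M]

open Functor.LaxLeftLinear

/-- The strong module functor obtained from a lax one with invertible lineator. -/
noncomputable abbrev leftLinearOfIsIso {N P : Type*} [Category* N] [Category* P]
    [MonoidalLeftAction C N] [MonoidalLeftAction C P] (F : N ⥤ P) [F.LaxLeftLinear C]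
    (h : ∀ (c : C) (x : N), IsIso (μₗ F c x)) : F.LeftLinear C where
  δₗ c x := inv (μₗ F c x)
  δₗ_naturality_left f x := by
    rw [IsIso.comp_inv_eq, Category.assoc, μₗ_naturality_left, IsIso.inv_hom_id_assoc]
  δₗ_naturality_right c _ _ f := by
    rw [IsIso.comp_inv_eq, Category.assoc, μₗ_naturality_right, IsIso.inv_hom_id_assoc]
  δₗ_associativity c c' x := by
    rw [IsIso.inv_comp_eq, μₗ_associativity_assoc]
    simp [← actionHomRight_comp]
  δₗ_unitality_inv x := by
    rw [← μₗ_unitality_inv, Category.assoc, IsIso.hom_inv_id, Category.comp_id]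
  μₗ_comp_δₗ c x := IsIso.hom_inv_id _
  δₗ_comp_μₗ c x := IsIso.inv_hom_id _

theorem IsAlgebraic.exists_generator (h : IsAlgebraic C M) :
    ∃ m : M, IsTensorAdmissible C m ∧ IsCGenerator C m := by
  obtain ⟨A, _, F, _, ⟨_⟩⟩ := h
  let e := (F.objObjPreimageIso (RightMod.regular A)).symm
  exact ⟨_, ⟨isIso_lineator_of_algebraic F e, isLeftAdjoint_iHom_of_algebraic F e⟩,
    isCGenerator_of_algebraic F e⟩

theorem isIHomEquivalence_iff [Balanced M] [Limits.HasCoequalizers M] (m : M) :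
    IsIHomEquivalence C m ↔ IsTensorAdmissible C m ∧ IsCGenerator C m := by
  constructor
  · rintro ⟨_, h⟩
    -- `iHom(m, -)` sends `m` to `A_m`, so it is an equivalence of the kind treated above.
    let _ := leftLinearOfIsIso (iHomMod C m) h
    have e : RightMod.regular (iEnd C m) ≅ (iHomMod C m).obj m := Iso.refl _
    exact ⟨⟨isIso_lineator_of_algebraic _ e, isLeftAdjoint_iHom_of_algebraic _ e⟩,
      isCGenerator_of_algebraic _ e⟩
  · rintro ⟨⟨h, _⟩, h'⟩
    have (c : C) : IsIso (iHom.lineator C m c m) := h c m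
    exact ⟨isEquivalence_iHomMod m h', fun c x => RightMod.isIso_of_isIso_hom _ (h c x)⟩

theorem IsIHomEquivalence.isAlgebraic {m : M} (h : IsIHomEquivalence C m) : IsAlgebraic C M :=
  ⟨iEnd C m, inferInstance, iHomMod C m, h.1, ⟨leftLinearOfIsIso _ h.2⟩⟩

end

/-! ### Right comodules and the forgetful functor -/

namespace RightComod

section

variable {C : Type u₁} [Category.{v₁} C] [MonoidalCategory C] {Z : C} [ComonObj Z]

variable (Z) in
/-- The functor forgetting the coaction of `Z`. -/
@[simps]
def forget : RightComod Z ⥤ C where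
  obj N := N.X
  map f := f.hom

instance : (forget Z).Faithful where
  map_injective h := hom_ext _ _ h

instance : (forget Z).ReflectsIsomorphisms where
  reflects {_ _} f hf :=
    have : IsIso f.hom := hf
    (isoMk (asIso f.hom) f.coact_hom).isIso_hom

theorem isIso_hom {N P : RightComod Z} (f : N ⟶ P) [IsIso f] : IsIso f.hom :=
  (forget Z).map_isIso f

theorem isIso_of_isIso_hom {N P : RightComod Z} (f : N ⟶ P) (h : IsIso f.hom) : IsIso f :=
  have : IsIso ((forget Z).map f) := h
  isIso_of_reflects_iso f (forget Z)

end

section Free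

variable {C : Type u₁} [Category.{v₁} C] [MonoidalCategory C] {Z : C}

section

variable {L : C ⥤ C} (adj : L ⊣ tensorRight Z)

/-- The adjunction bijection `Hom(x, y ⊗ Z) → Hom(L x, y)`. -/
def uncurryRight {x y : C} (f : x ⟶ y ⊗ Z) : L.obj x ⟶ y := (adj.homEquiv x y).symm f

/-- The coevaluation `x ⟶ L x ⊗ Z`. -/
def coevRight (x : C) : x ⟶ L.obj x ⊗ Z := adj.unit.app x

theorem coev_uncurryRight {x y : C} (f : x ⟶ y ⊗ Z) :
    coevRight adj x ≫ uncurryRight adj f ▷ Z = f :=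
  ((adj.homEquiv_unit _ _ _).symm.trans ((adj.homEquiv x y).apply_symm_apply f))

theorem coev_uncurryRight_assoc {x y w : C} (f : x ⟶ y ⊗ Z) (g : y ⊗ Z ⟶ w) :
    coevRight adj x ≫ uncurryRight adj f ▷ Z ≫ g = f ≫ g := by
  rw [← Category.assoc, coev_uncurryRight]

theorem hom_ext_of_coevRight {x y : C} {f g : L.obj x ⟶ y}
    (h : coevRight adj x ≫ f ▷ Z = coevRight adj x ≫ g ▷ Z) : f = g :=
  (adj.homEquiv x y).injective
    ((adj.homEquiv_unit _ _ _).trans (h.trans (adj.homEquiv_unit _ _ _).symm))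

end

variable [ComonObj Z] {L : C ⥤ C} (adj : L ⊣ tensorRight Z)

/-- The free comodule `L x`, for `L` left adjoint to `- ⊗ Z`. Its coaction is determined by
`x ⟶ L x ⊗ Z ⟶ (L x ⊗ Z) ⊗ Z`, coevaluation followed by comultiplication in `Z`. -/
def free (x : C) : RightComod Z where
  X := L.obj x
  coact := uncurryRight adj (coevRight adj x ≫ L.obj x ◁ ComonObj.comul ≫ (α_ _ _ _).inv)
  coact_counit := hom_ext_of_coevRight adj (by
    have h : L.obj x ◁ ComonObj.comul ≫ L.obj x ◁ (ComonObj.counit (X := Z)) ▷ Z =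
        L.obj x ◁ (λ_ Z).inv := by
      rw [← MonoidalCategory.whiskerLeft_comp, ComonObj.counit_comul]
    rw [comp_whiskerRight, coev_uncurryRight_assoc]
    simp [reassoc_of% h])
  coact_comul := hom_ext_of_coevRight adj (by
    have h : L.obj x ◁ ComonObj.comul ≫ L.obj x ◁ (ComonObj.comul (X := Z)) ▷ Z =
        L.obj x ◁ ComonObj.comul ≫ L.obj x ◁ Z ◁ ComonObj.comul ≫
          L.obj x ◁ (α_ Z Z Z).inv := by
      simp only [← MonoidalCategory.whiskerLeft_comp]
      rw [ComonObj.comul_assoc_flip]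
    simp only [comp_whiskerRight]
    rw [coev_uncurryRight_assoc, coev_uncurryRight_assoc]
    simp only [Category.assoc]
    rw [← associator_inv_naturality_left_assoc, whisker_exchange_assoc, coev_uncurryRight_assoc]
    simp [reassoc_of% h])

theorem coact_freeLift_hom (N : RightComod Z) {x : C} (f : x ⟶ N.X) :
    uncurryRight adj (coevRight adj x ≫ L.obj x ◁ ComonObj.comul ≫ (α_ _ _ _).inv) ≫
      uncurryRight adj (f ≫ N.coact) ▷ Z =
      uncurryRight adj (f ≫ N.coact) ≫ N.coact :=
  hom_ext_of_coevRight adj (by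
    have h := N.coact_comul
    simp only [comp_whiskerRight]
    rw [coev_uncurryRight_assoc, coev_uncurryRight_assoc, Category.assoc, Category.assoc,
      ← associator_inv_naturality_left, whisker_exchange_assoc, coev_uncurryRight_assoc,
      Category.assoc, reassoc_of% h]
    simp)

theorem coev_uncurryRight_counit (N : RightComod Z) {x : C} (g : L.obj x ⟶ N.X)
    (hg : uncurryRight adj (coevRight adj x ≫ L.obj x ◁ ComonObj.comul ≫ (α_ _ _ _).inv) ≫ g ▷ Z =
      g ≫ N.coact) :
    (coevRight adj x ≫ g ▷ Z ≫ N.X ◁ ComonObj.counit (X := Z) ≫ (ρ_ N.X).hom) ≫ N.coact =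
      coevRight adj x ≫ g ▷ Z := by
  have h : coevRight adj x ≫ g ▷ Z ≫ N.coact ▷ Z =
      coevRight adj x ≫ L.obj x ◁ ComonObj.comul ≫ (α_ _ _ _).inv ≫ g ▷ Z ▷ Z := by
    rw [← comp_whiskerRight, ← hg, comp_whiskerRight, coev_uncurryRight_assoc]
    simp
  have h' : L.obj x ◁ ComonObj.comul ≫ L.obj x ◁ Z ◁ ComonObj.counit (X := Z) =
      L.obj x ◁ (ρ_ Z).inv := by
    rw [← MonoidalCategory.whiskerLeft_comp, ComonObj.comul_counit]
  simp only [Category.assoc]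
  rw [← rightUnitor_naturality, whisker_exchange_assoc, reassoc_of% h, ← whisker_exchange_assoc]
  simp [reassoc_of% h']

theorem coev_comp_counit {x X Y : C} (f : L.obj x ⟶ X) (g : X ⟶ Y) :
    coevRight adj x ≫ (f ≫ g) ▷ Z ≫ Y ◁ ComonObj.counit (X := Z) ≫ (ρ_ Y).hom =
      (coevRight adj x ≫ f ▷ Z ≫ X ◁ ComonObj.counit (X := Z) ≫ (ρ_ X).hom) ≫ g := by
  simp [← whisker_exchange_assoc]

/-- Morphisms out of the free comodule `L x` are morphisms out of `x`. -/
def freeHomEquiv (N : RightComod Z) (x : C) : (free adj x ⟶ N) ≃ (x ⟶ N.X) where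
  toFun g := coevRight adj x ≫ g.hom ▷ Z ≫ N.X ◁ ComonObj.counit (X := Z) ≫ (ρ_ N.X).hom
  invFun f := ⟨uncurryRight adj (f ≫ N.coact), coact_freeLift_hom adj N f⟩
  left_inv g := hom_ext _ _ (hom_ext_of_coevRight adj ((coev_uncurryRight adj _).trans
    (coev_uncurryRight_counit adj N g.hom g.coact_hom)))
  right_inv f := by
    have h := N.coact_counit
    change _ ≫ uncurryRight adj _ ▷ Z ≫ _ = _
    rw [coev_uncurryRight_assoc, Category.assoc, reassoc_of% h]
    simp

/-- The forgetful functor is right adjoint to the free comodule functor. -/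
theorem isRightAdjoint_forget [(tensorRight Z).IsRightAdjoint] : (forget Z).IsRightAdjoint :=
  (Adjunction.adjunctionOfEquivLeft (G := forget Z)
    (F_obj := free (Adjunction.ofIsRightAdjoint (tensorRight Z)))
    (fun x N => freeHomEquiv (Adjunction.ofIsRightAdjoint (tensorRight Z)) N x)
    (fun x N N' g f => by
      exact coev_comp_counit (Adjunction.ofIsRightAdjoint (tensorRight Z)) f.hom
        g.hom)).isRightAdjoint

end Free

end RightComod

/-! ### Comonadicity of the internal coHom -/

section CoComparison

variable {C : Type u₁} [Category.{v₁} C] [MonoidalCategory C]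
  {M : Type u₂} [Category.{v₂} M] [MonoidalLeftAction C M]
  (n : M) [(actionRight C n).IsRightAdjoint]

namespace icoHom

/-- The evaluation `icoHom(n, c ▷ n) ⟶ c`. -/
noncomputable def ev (c : C) : (icoHom C n).obj (c ⊙ₗ n) ⟶ c := (adj C n).counit.app c

theorem coev_ev (c : C) : coev C n (c ⊙ₗ n) ≫ ev n c ⊵ₗ n = 𝟙 _ :=
  (adj C n).right_triangle_components c

theorem coev_ev_assoc (c : C) {x : M} (f : c ⊙ₗ n ⟶ x) :
    coev C n (c ⊙ₗ n) ≫ ev n c ⊵ₗ n ≫ f = f := by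
  rw [← Category.assoc, coev_ev, Category.id_comp]

/-- The colineators intertwine the counit of the comonad `icoHom(n, - ▷ n)` with the counit of the
coalgebra `icoHom(n, n)`. -/
theorem colineator_counit (c : C) :
    colineator C n c n ≫ c ◁ counit C n = ev n c ≫ (ρ_ c).inv :=
  hom_ext (by
    have h := congrArg (c ⊴ₗ ·) (coev_counit C n)
    simp only [actionHomRight_comp] at h
    simp [coev_ev_assoc, reassoc_of% h, rightUnitor_inv_actionHom])

theorem map_coev_colineator (x : M) :
    (icoHom C n).map (coev C n x) ≫ colineator C n ((icoHom C n).obj x) n = comp C n n x :=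
  hom_ext (by simp)

theorem map_actionHomLeft_colineator {c d : C} (f : c ⟶ d) (x : M) :
    (icoHom C n).map (f ⊵ₗ x) ≫ colineator C n d x =
      colineator C n c x ≫ f ▷ (icoHom C n).obj x :=
  Functor.OplaxLeftLinear.δₗ_naturality_left (icoHom C n) f x

/-- The colineators intertwine the comultiplication of the comonad `icoHom(n, - ▷ n)` with the
comultiplication of the coalgebra `icoHom(n, n)`. -/
theorem map_coev_colineator_whiskerRight (c : C) :
    (icoHom C n).map (coev C n (c ⊙ₗ n)) ≫ colineator C n ((icoHom C n).obj (c ⊙ₗ n)) n ≫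
      colineator C n c n ▷ (icoHom C n).obj n =
        colineator C n c n ≫ c ◁ comp C n n n ≫ (α_ c _ _).inv := by
  rw [← colineator_comp, ← map_coev_colineator, Category.assoc]

variable {n}

theorem coalgebra_coact_counit {X : C} (a : X ⟶ (icoHom C n).obj (X ⊙ₗ n)) (h : a ≫ ev n X = 𝟙 X) :
    (a ≫ colineator C n X n) ≫ X ◁ counit C n = (ρ_ X).inv := by
  rw [Category.assoc, colineator_counit, reassoc_of% h]

theorem coalgebra_coact_comul {X : C} (a : X ⟶ (icoHom C n).obj (X ⊙ₗ n))
    (h : a ≫ (icoHom C n).map (coev C n (X ⊙ₗ n)) = a ≫ (icoHom C n).map (a ⊵ₗ n)) :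
    (a ≫ colineator C n X n) ≫ X ◁ comp C n n n = (a ≫ colineator C n X n) ≫
      (a ≫ colineator C n X n) ▷ (icoHom C n).obj n ≫ (α_ X _ _).hom := by
  have h' := map_coev_colineator_whiskerRight n X
  rw [← cancel_mono (α_ X ((icoHom C n).obj n) ((icoHom C n).obj n)).inv]
  simp only [Category.assoc, Iso.hom_inv_id, Category.comp_id, comp_whiskerRight]
  rw [← h', reassoc_of% h, reassoc_of% (map_actionHomLeft_colineator n a n)]

theorem coalgebra_hom {X Y : C} (a : X ⟶ (icoHom C n).obj (X ⊙ₗ n))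
    (b : Y ⟶ (icoHom C n).obj (Y ⊙ₗ n)) (f : X ⟶ Y) (h : a ≫ (icoHom C n).map (f ⊵ₗ n) = f ≫ b) :
    (a ≫ colineator C n X n) ≫ f ▷ (icoHom C n).obj n = f ≫ b ≫ colineator C n Y n := by
  rw [Category.assoc, ← map_actionHomLeft_colineator, reassoc_of% h]

theorem coalgebra_hom_of_comodule_hom {X Y : C} [IsIso (colineator C n Y n)]
    (a : X ⟶ (icoHom C n).obj (X ⊙ₗ n)) (b : Y ⟶ (icoHom C n).obj (Y ⊙ₗ n)) (f : X ⟶ Y)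
    (h : (a ≫ colineator C n X n) ≫ f ▷ (icoHom C n).obj n = f ≫ b ≫ colineator C n Y n) :
    a ≫ (icoHom C n).map (f ⊵ₗ n) = f ≫ b := by
  rw [← cancel_mono (colineator C n Y n), Category.assoc, Category.assoc, ← h,
    map_actionHomLeft_colineator, Category.assoc]

theorem coact_inv_colineator {X : C} [IsIso (colineator C n X n)]
    (a : X ⟶ X ⊗ (icoHom C n).obj n) :
    ((a ≫ inv (colineator C n X n)) ≫ colineator C n X n) ≫ 𝟙 X ▷ (icoHom C n).obj n =
      𝟙 X ≫ a := by
  simp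

theorem coalgebra_counit_of_comodule {X : C} [IsIso (colineator C n X n)]
    (a : X ⟶ X ⊗ (icoHom C n).obj n) (h : a ≫ X ◁ counit C n = (ρ_ X).inv) :
    (a ≫ inv (colineator C n X n)) ≫ ev n X = 𝟙 X := by
  rw [← cancel_mono (ρ_ X).inv, Category.assoc, Category.assoc, ← colineator_counit,
    IsIso.inv_hom_id_assoc, h, Category.id_comp]

theorem coalgebra_coassoc_of_comodule {X : C} [∀ c : C, IsIso (colineator C n c n)]
    (a : X ⟶ X ⊗ (icoHom C n).obj n)
    (h : a ≫ X ◁ comp C n n n = a ≫ a ▷ (icoHom C n).obj n ≫ (α_ X _ _).hom) :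
    (a ≫ inv (colineator C n X n)) ≫ (icoHom C n).map (coev C n (X ⊙ₗ n)) =
      (a ≫ inv (colineator C n X n)) ≫
        (icoHom C n).map ((a ≫ inv (colineator C n X n)) ⊵ₗ n) := by
  rw [← cancel_mono (colineator C n ((icoHom C n).obj (X ⊙ₗ n)) n),
    ← cancel_mono (colineator C n X n ▷ (icoHom C n).obj n)]
  simp only [Category.assoc]
  rw [map_coev_colineator_whiskerRight, IsIso.inv_hom_id_assoc, reassoc_of% h,
    reassoc_of% (map_actionHomLeft_colineator n (a ≫ inv (colineator C n X n)) n),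
    IsIso.inv_hom_id_assoc, ← comp_whiskerRight, Category.assoc, IsIso.inv_hom_id,
    Category.comp_id, Iso.hom_inv_id, Category.comp_id]

end icoHom

/-- A coalgebra over the comonad `icoHom(n, - ▷ n)` is a right comodule over `icoHom(n, n)`, by
composition with the colineator `icoHom(n, X ▷ n) ⟶ X ⊗ icoHom(n, n)`. -/
noncomputable def coalgebraToRightComod :
    (icoHom.adj C n).toComonad.Coalgebra ⥤ RightComod (icoEnd C n) where
  obj S :=
    { X := S.A
      coact := S.a ≫ icoHom.colineator C n S.A n
      coact_counit := icoHom.coalgebra_coact_counit S.a S.counit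
      coact_comul := icoHom.coalgebra_coact_comul S.a S.coassoc }
  map {S T} f := ⟨f.f, icoHom.coalgebra_hom S.a T.a f.f f.h⟩

theorem icoHomComod_coact_eq (x : M) :
    ((icoHom C n).map (icoHom.coev C n x) ≫ icoHom.colineator C n ((icoHom C n).obj x) n) ≫
      𝟙 ((icoHom C n).obj x) ▷ (icoHom C n).obj n = 𝟙 _ ≫ icoHom.comp C n n x := by
  simp [icoHom.map_coev_colineator]

/-- The functor `icoHom(n, -) : M ⥤ comod-C_n` is the comonadic comparison functor. -/
noncomputable def cocomparisonIso :
    Comonad.comparison (icoHom.adj C n) ⋙ coalgebraToRightComod n ≅ icoHomComod C n :=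
  NatIso.ofComponents
    (fun x => RightComod.isoMk (Iso.refl ((icoHom C n).obj x)) (icoHomComod_coact_eq n x))
    (fun f => RightComod.hom_ext _ _
      ((Category.comp_id ((icoHom C n).map f)).trans (Category.id_comp _).symm))

/-- If the colineators `icoHom(n, c ▷ n) ⟶ c ⊗ icoHom(n, n)` are invertible, then the comonad
`icoHom(n, - ▷ n)` is `- ⊗ icoHom(n, n)`, so the two notions of comodules agree. -/
instance isEquivalence_coalgebraToRightComod [∀ c : C, IsIso (icoHom.colineator C n c n)] :
    (coalgebraToRightComod (C := C) n).IsEquivalence where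
  faithful := ⟨fun h => Comonad.Coalgebra.Hom.ext (congrArg RightComod.Hom.hom h)⟩
  full := ⟨fun {S T} f =>
    ⟨⟨f.hom, icoHom.coalgebra_hom_of_comodule_hom S.a T.a f.hom f.coact_hom⟩, rfl⟩⟩
  essSurj := ⟨fun N => ⟨
    { A := N.X
      a := show N.X ⟶ (icoHom C n).obj (N.X ⊙ₗ n) from
        (show N.X ⟶ N.X ⊗ (icoHom C n).obj n from N.coact) ≫ inv (icoHom.colineator C n N.X n)
      counit := icoHom.coalgebra_counit_of_comodule (X := N.X) N.coact N.coact_counit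
      coassoc := icoHom.coalgebra_coassoc_of_comodule (X := N.X) N.coact N.coact_comul },
    ⟨RightComod.isoMk (Iso.refl N.X) (icoHom.coact_inv_colineator (X := N.X) N.coact)⟩⟩⟩

end CoComparison

section Comonadic

variable {C : Type u₁} [Category.{v} C] [MonoidalCategory C]
  {M : Type u₂} [Category.{v} M] [MonoidalLeftAction C M]
  (n : M) [(actionRight C n).IsRightAdjoint]

/-- If `n` is a cogenerator, then the coevaluations `x ⟶ icoHom(n, x) ▷ n` are monomorphisms,
so that `icoHom(n, -)` is faithful. -/
theorem faithful_icoHom (h : ∀ x : M, ∃ (c : C) (f : x ⟶ c ⊙ₗ n), Mono f) :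
    (icoHom C n).Faithful := by
  have h' (x : M) : Mono (icoHom.coev C n x) := by
    obtain ⟨c, f, hf⟩ := h x
    rw [← icoHom.coev_lift f] at hf
    exact mono_of_mono _ (icoHom.lift f ⊵ₗ n)
  have (x : M) : Mono ((icoHom.adj C n).unit.app x) := h' x
  exact (icoHom.adj C n).faithful_L_of_mono_unit_app

/-- In a balanced category, the faithful functor `icoHom(n, -)` reflects isomorphisms, so the crude
comonadicity theorem applies. -/
theorem isEquivalence_icoHomComod [Balanced M] [Limits.HasEqualizers M]
    [∀ c : C, IsIso (icoHom.colineator C n c n)] [(icoHom C n).IsRightAdjoint]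
    (h : ∀ x : M, ∃ (c : C) (f : x ⟶ c ⊙ₗ n), Mono f) : (icoHomComod C n).IsEquivalence := by
  have := faithful_icoHom n h
  have : (icoHom C n).ReflectsIsomorphisms := inferInstance
  have : Limits.PreservesLimits (icoHom C n) :=
    (Adjunction.ofIsRightAdjoint (icoHom C n)).rightAdjoint_preservesLimits
  have : Comonad.PreservesLimitOfIsCoreflexivePair (icoHom C n) :=
    ⟨fun _ _ _ _ _ => inferInstance⟩
  have : (Comonad.comparison (icoHom.adj C n)).IsEquivalence :=
    (Comonad.comonadicOfHasPreservesCoreflexiveEqualizersOfReflectsIsomorphisms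
      (icoHom.adj C n)).eqv
  exact Functor.isEquivalence_of_iso (cocomparisonIso n)

end Comonadic

section

variable {C : Type u₁} [Category.{v₁} C] [MonoidalCategory C]
  {M : Type u₂} [Category.{v₂} M] [MonoidalLeftAction C M]
  (n : M) [(actionRight C n).IsRightAdjoint]

theorem isRightAdjoint_icoHom [(icoHomComod C n).IsEquivalence]
    [(tensorRight (icoEnd C n)).IsRightAdjoint] : (icoHom C n).IsRightAdjoint :=
  have := RightComod.isRightAdjoint_forget (Z := icoEnd C n)
  inferInstanceAs (icoHomComod C n ⋙ RightComod.forget (icoEnd C n)).IsRightAdjoint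

/-- Up to the colineator, `icoHom(n, -)` sends the coevaluation `x ⟶ icoHom(n, x) ▷ n` to the
coaction on `icoHom(n, x)`, which is a split monomorphism. -/
theorem mono_coev [(icoHom C n).Faithful] (x : M) : Mono (icoHom.coev C n x) := by
  have h : ((icoHom C n).map (icoHom.coev C n x) ≫
      icoHom.colineator C n ((icoHom C n).obj x) n) ≫
        (icoHom C n).obj x ◁ icoHom.counit C n ≫ (ρ_ _).hom = 𝟙 _ := by
    rw [icoHom.map_coev_colineator, reassoc_of% (icoHom.counit_comp C n x), Iso.inv_hom_id]
  rw [Category.assoc] at h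
  have : IsSplitMono ((icoHom C n).map (icoHom.coev C n x)) := ⟨⟨⟨_, h⟩⟩⟩
  exact (icoHom C n).mono_of_mono_map inferInstance

end

section

variable {C : Type u₁} [Category.{v} C] [MonoidalCategory C] [GVCategory C]
  {M : Type u₂} [Category.{v} M] [MonoidalLeftAction C M] [GVModule C M]

theorem isICoHomEquivalence_iff [Balanced M] [Limits.HasEqualizers M] (n : M) :
    IsICoHomEquivalence C n ↔ IsParAdmissible C n ∧ IsCCogenerator C n := by
  constructor
  · rintro ⟨_, h⟩
    have : (icoHom (Par C) n).Faithful := inferInstanceAs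
      (icoHomComod (Par C) n ⋙ RightComod.forget (icoEnd (Par C) n)).Faithful
    exact ⟨⟨fun c x => RightComod.isIso_hom
      (Functor.OplaxLeftLinear.δₗ (icoHomComod (Par C) n) c x), isRightAdjoint_icoHom n⟩,
      fun x => ⟨_, icoHom.coev (Par C) n x, mono_coev n x⟩⟩
  · rintro ⟨⟨h, _⟩, h'⟩
    have (c : Par C) : IsIso (icoHom.colineator (Par C) n c n) := h c n
    exact ⟨isEquivalence_icoHomComod n h', fun c x => RightComod.isIso_of_isIso_hom _ (h c x)⟩

end

end GV

theorem mainTheorem7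
    (C : Type u₁) [Category.{v} C] [MonoidalCategory C] [GV.GVCategory C]
    (M : Type u₂) [Category.{v} M] [MonoidalLeftAction C M] [GV.GVModule C M] :
    (GV.IsAlgebraic C M → ∃ m : M, GV.IsTensorAdmissible C m ∧ GV.IsCGenerator C m) ∧
    (Balanced M → Limits.HasCoequalizers M →
      (GV.IsAlgebraic C M ↔ ∃ m : M, GV.IsTensorAdmissible C m ∧ GV.IsCGenerator C m) ∧
      ∀ m : M, GV.IsIHomEquivalence C m ↔ (GV.IsTensorAdmissible C m ∧ GV.IsCGenerator C m)) ∧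
    (Balanced M → Limits.HasEqualizers M →
      ∀ n : M, GV.IsICoHomEquivalence C n ↔ (GV.IsParAdmissible C n ∧ GV.IsCCogenerator C n)) := by
  refine ⟨fun h => h.exists_generator, fun _ _ => ⟨⟨fun h => h.exists_generator, ?_⟩,
    fun m => GV.isIHomEquivalence_iff m⟩, fun _ _ n => GV.isICoHomEquivalence_iff n⟩
  rintro ⟨m, h⟩
  exact ((GV.isIHomEquivalence_iff m).mpr h).isAlgebraic
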